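/- **Setting.** Let $d\ge1$, $\Theta\subset\mathbb R^{q}$, let $\mathbb A\subset\mathbb R^{k}$ be non-empty and compact, and let $\bar\mu:\Theta\times\mathbb R^d\times\mathbb A\to\mathbb R^d$, $(\theta,x,a)\mapsto\bar\mu_\theta(x,a)$, and $\bar r:\mathbb R^d\times\mathbb A\to\mathbb R$ be continuous and $\bar\Sigma\in\mathbb R^{d\times d}$. Assume: (A1) there is $L_0>0$ with $\|\bar\Sigma\|_{\rm op}<L_0$ such that, for all $(\theta,a)\in\Theta\times\mathbb A$, $$\sup_{x}\frac{\|\bar\mu_\theta(x,a)\|}{1+\|x\|}+\sup_{x\ne x'}\frac{\|\bar\mu_\theta(x,a)-\bar\mu_\theta(x',a)\|}{\|x-x'\|}+\sup_x|\bar r(x,a)|+\sup_{x\neq x'}\frac{|\bar r(x,a)-\bar r(x',a)|}{\|x-x'\|}<L_0,$$ and $\bar\Sigma\bar\Sigma^\top\succeq\varsigma I_d$ for some $\varsigma>0$; (A2) there are $\ell,L,c,B>0$ and $V:\mathbb R^d\to[0,\infty)$ with $V(0)=0$, positive and $C^2$ on $\mathbb R^d\setminus\{0\}$, with $\|\nabla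 V\|\le B$ on $\mathbb R^d\setminus\{0\}$, such that for all $x\ne x'$ in $\mathbb R^d$, $a\in\mathbb A$, $\theta\in\Theta$ and $\varepsilon\in(0,1)$: $\ell\|x-x'\|\le V(x-x')\le L\|x-x'\|$ and $V(x+\varepsilon\bar\mu_\theta(x,a)-x'-\varepsilon\bar\mu_\theta(x',a))\le(1-\varepsilon c)V(x-x')$. For $\varepsilon\in(0,1]$ put $\mu_\theta=\varepsilon\bar\mu_\theta$, $\Sigma=\varepsilon^{1/2}\bar\Sigma$, $r=\varepsilon\bar r$. On a probability space let $0=\tau_0,\tau_1,\tau_2,\dots$ be the arrival times of a Poisson process of intensity $\varepsilon^{-1}$, $N_t$ the number of arrivals $\tau_n\le t$, $n\geq 1$, and $(\xi_n)_{n\ge0}$ i.i.d. standard Gaussian marks in $\mathbb R^d$, independent of $(\tau_n)$. Let $\mathbb F$ be the filtration $\sigma((\tau_n,\xi_n)_{\tau_n\le t})$, augmented by the null events, and let $\mathcal A$ be the set of $\mathbb A$-valued $\mathbb F$-progressively measurable processes. For $x_0\in\mathbb R^d$ and $\alpha\in\mathcal A$ let $X=X^{x_0,\alpha,\theta}$ satisfy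 $X_{\tau_0}=x_0$, $X_{\tau_{n}}=X_{\tau_{n-1}}+\mu_\theta(X_{\tau_{n-1}},\alpha_{\tau_{n-1}})+\Sigma\xi_{n}$, and be constant on each $[\tau_{n-1},\tau_n)$. Let $$\rho^\alpha_\theta(x_0)=\liminf_{T\to\infty}\frac1T\,\mathbb E\Big[\sum_{n=1}^{N_T}r(X_{\tau_n},\alpha_{\tau_n})\Big],\qquad\rho^*_\theta(x_0)=\sup_{\alpha\in\mathcal A}\rho^\alpha_\theta(x_0).$$ **Proposition.** There is $L_W\in(0,\infty)$, independent of $\varepsilon\in(0,1]$ and of $\theta$, such that for all such $\varepsilon$ and all $\theta\in\Theta$: (i) $x\mapsto\rho^*_\theta(x)$ is constant, with a finite value $\rho^*_\theta\in\mathbb R$; (ii) there is an $L_W$-Lipschitz function $W^*_\theta:\mathbb R^d\to\mathbb R$ such that, with $\xi$ standard Gaussian in $\mathbb R^d$, for all $x\in\mathbb R^d$, $$\varepsilon\rho^*_\theta=\max_{a\in\mathbb A}\big\{\mathbb E[W^*_\theta(x+\mu_\theta(x,a)+\Sigma\xi)]-W^*_\theta(x)+r(x,a)\big\},$$ the maximum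 being attained; (iii) there is a measurable $\pi:\mathbb R^d\to\mathbb A$ such that $\pi(x)$ maximises the right-hand side for every $x$; and every such $\pi$ is optimal: for every $x_0$ there is a control $\alpha\in\mathcal A$ such that, almost surely, $\alpha_t=\pi(X^{x_0,\alpha,\theta}_t)$ for all $t\ge0$, and every such $\alpha$ satisfies $\rho^\alpha_\theta(x_0)=\rho^*_\theta$. -/

import Mathlib

open MeasureTheory ProbabilityTheory Filter Topology Set
open scoped NNReal ENNReal

noncomputable section

/-- `ℝⁿ` with the Euclidean norm. -/
abbrev Vec (n : ℕ) := EuclideanSpace ℝ (Fin n)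

/-- A marked Poisson process with mean inter-arrival time `ε` (intensity `ε⁻¹`): arrival times
`τ 0 = 0, τ 1, τ 2, …` whose increments are i.i.d. exponential of rate `ε⁻¹`, and marks `ξ n` which
are i.i.d. standard Gaussian on `ℝᵈ`, the times being independent of the marks. -/
structure MarkedPoisson (d : ℕ) (ε : ℝ) {Ω : Type*} [MeasurableSpace Ω] (P : Measure Ω) where
  τ : ℕ → Ω → ℝ≥0
  ξ : ℕ → Ω → Vec d
  measurable_τ : ∀ n, Measurable (τ n)
  measurable_ξ : ∀ n, Measurable (ξ n)
  τ_zero : ∀ ω, τ 0 ω = 0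
  law_gap : ∀ n, HasLaw (fun ω => (τ (n + 1) ω : ℝ) - (τ n ω : ℝ)) (expMeasure ε⁻¹) P
  indep_gap : iIndepFun (fun n ω => (τ (n + 1) ω : ℝ) - (τ n ω : ℝ)) P
  law_ξ : ∀ n, HasLaw (ξ n) (stdGaussian (Vec d)) P
  indep_ξ : iIndepFun ξ P
  indep_τ_ξ : IndepFun (fun ω n => τ n ω) (fun ω n => ξ n ω) P

namespace MarkedPoisson

variable {d : ℕ} {ε : ℝ} {Ω : Type*} [mΩ : MeasurableSpace Ω] {P : Measure Ω}

/-- The number `N_t` of arrivals (not counting time `0` itself) up to time `t`. It is finite almost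
surely. -/
def count (N : MarkedPoisson d ε P) (t : ℝ≥0) (ω : Ω) : ℕ :=
  Set.ncard {n : ℕ | 1 ≤ n ∧ N.τ n ω ≤ t}

/-- The events `{τ n ≤ u, ξ n ∈ B}` with `u ≤ t`, which generate `σ((τ n, ξ n) ; τ n ≤ t)`. -/
def observed (N : MarkedPoisson d ε P) (t : ℝ≥0) : Set (Set Ω) :=
  {s | ∃ (n : ℕ) (u : ℝ≥0) (B : Set (Vec d)), u ≤ t ∧ MeasurableSet B ∧
    s = {ω | N.τ n ω ≤ u ∧ N.ξ n ω ∈ B}}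

/-- The filtration generated by the observed arrivals and marks, augmented by the null events of
the underlying probability space. -/
def filtration (N : MarkedPoisson d ε P) : Filtration ℝ≥0 mΩ where
  seq t := MeasurableSpace.generateFrom (N.observed t ∪ {s | MeasurableSet s ∧ P s = 0})
  mono' := by
    intro s t hst
    apply MeasurableSpace.generateFrom_mono
    apply Set.union_subset_union_left
    rintro A ⟨n, u, B, hu, hB, rfl⟩
    exact ⟨n, u, B, hu.trans hst, hB, rfl⟩
  le' := by
    intro t
    apply MeasurableSpace.generateFrom_le
    rintro A (⟨n, u, B, -, hB, rfl⟩ | hA)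
    · exact (measurableSet_le (N.measurable_τ n) measurable_const).inter (N.measurable_ξ n hB)
    · exact hA.1

end MarkedPoisson

/-- The rescaled coefficients of the control problem: a parameter set `Θ ⊆ ℝ^q`, an action set
`𝔸 ⊆ ℝ^k`, a drift `μ̄_θ(x, a)`, a reward `r̄(x, a)` and a volatility matrix `Σ̄`. -/
structure JumpModel (d k q : ℕ) where
  Theta : Set (Vec q)
  Act : Set (Vec k)
  drift : Theta → Vec d → Act → Vec d
  reward : Vec d → Act → ℝ
  vol : Matrix (Fin d) (Fin d) ℝ

namespace JumpModel

variable {d k q : ℕ}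

/-- Continuity of the coefficients, linear growth and Lipschitz continuity of the drift, boundedness
and Lipschitz continuity of the reward (all uniformly in parameter and action), and boundedness and
non-degeneracy of the noise. The suprema are taken in `[0, ∞]`. -/
def Regular (M : JumpModel d k q) : Prop :=
  Continuous (fun p : M.Theta × Vec d × M.Act => M.drift p.1 p.2.1 p.2.2) ∧
  Continuous (fun p : Vec d × M.Act => M.reward p.1 p.2) ∧
  (∃ L₀ : ℝ, 0 < L₀ ∧
    (∀ (θ : M.Theta) (a : M.Act),
      (⨆ x : Vec d, ‖M.drift θ x a‖ₑ / (1 + ‖x‖ₑ)) +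
      (⨆ (x : Vec d) (x' : Vec d) (_ : x ≠ x'), ‖M.drift θ x a - M.drift θ x' a‖ₑ / ‖x - x'‖ₑ) +
      (⨆ x : Vec d, ‖M.reward x a‖ₑ) +
      (⨆ (x : Vec d) (x' : Vec d) (_ : x ≠ x'), ‖M.reward x a - M.reward x' a‖ₑ / ‖x - x'‖ₑ)
        < ENNReal.ofReal L₀) ∧
    ‖Matrix.toEuclideanCLM (n := Fin d) (𝕜 := ℝ) M.vol‖ < L₀) ∧
  ∃ ς : ℝ, 0 < ς ∧ (M.vol * M.vol.transpose - ς • (1 : Matrix (Fin d) (Fin d) ℝ)).PosSemidef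

/-- Existence of a Lyapunov function `V`, `C²` and positive off the origin and extended by
`V 0 = 0`, which is comparable to the norm, has bounded gradient off the origin, and is contracted
by `x ↦ x + ε μ̄_θ(x, a)` at rate `1 - ε c` for all `ε ∈ (0, 1)`. No bound on the Hessian is
required: in dimension at least two a Hessian bounded near the origin is incompatible with
`l ‖x‖ ≤ V x ≤ L ‖x‖`, and it would already exclude `V = ‖·‖`. -/
def Stable (M : JumpModel d k q) : Prop :=
  ∃ (l L c B : ℝ) (V : Vec d → ℝ),
    0 < l ∧ 0 < L ∧ 0 < c ∧ 0 < B ∧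
    V 0 = 0 ∧ (∀ x, x ≠ 0 → 0 < V x) ∧ ContDiffOn ℝ 2 V {0}ᶜ ∧
    (∀ x x', x ≠ x' → l * ‖x - x'‖ ≤ V (x - x') ∧ V (x - x') ≤ L * ‖x - x'‖) ∧
    (∀ x, x ≠ 0 → ‖gradient V x‖ ≤ B) ∧
    (∀ (θ : M.Theta) (a : M.Act) (x x' : Vec d) (ε : ℝ), x ≠ x' → ε ∈ Ioo (0 : ℝ) 1 →
      V (x + ε • M.drift θ x a - x' - ε • M.drift θ x' a) ≤ (1 - ε * c) * V (x - x'))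

/-- The transition `x ↦ x + μ_θ(x, a) + Σ z`, with `μ = ε μ̄` and `Σ = √ε Σ̄`. -/
def step (M : JumpModel d k q) (ε : ℝ) (θ : M.Theta) (x : Vec d) (a : M.Act) (z : Vec d) : Vec d :=
  x + ε • M.drift θ x a + Real.sqrt ε • Matrix.toEuclideanCLM (n := Fin d) (𝕜 := ℝ) M.vol z

/-- The expression `E[W(x + μ_θ(x, a) + Σ ξ)] - W(x) + r(x, a)`, with `ξ` standard Gaussian and
`r = ε r̄`. -/
def hamiltonian (M : JumpModel d k q) (ε : ℝ) (θ : M.Theta) (W : Vec d → ℝ) (x : Vec d)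
    (a : M.Act) : ℝ :=
  (∫ z, W (M.step ε θ x a z) ∂(stdGaussian (Vec d))) - W x + ε * M.reward x a

variable {ε : ℝ} {Ω : Type*} [MeasurableSpace Ω] {P : Measure Ω}

/-- The controls: `𝔸`-valued processes which are progressively measurable for the augmented
filtration of the marked Poisson process. -/
def controls (M : JumpModel d k q) (N : MarkedPoisson d ε P) : Set (ℝ≥0 → Ω → M.Act) :=
  {α | IsProgressive N.filtration α}

/-- The state `X_{τ n}` at the `n`-th arrival. -/
def stateAt (M : JumpModel d k q) (N : MarkedPoisson d ε P) (θ : M.Theta) (x₀ : Vec d)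
    (α : ℝ≥0 → Ω → M.Act) : ℕ → Ω → Vec d
  | 0, _ => x₀
  | n + 1, ω => M.step ε θ (stateAt M N θ x₀ α n ω) (α (N.τ n ω) ω) (N.ξ (n + 1) ω)

/-- The state `X_t`, piecewise constant between arrivals. -/
def state (M : JumpModel d k q) (N : MarkedPoisson d ε P) (θ : M.Theta) (x₀ : Vec d)
    (α : ℝ≥0 → Ω → M.Act) (t : ℝ≥0) (ω : Ω) : Vec d :=
  M.stateAt N θ x₀ α (N.count t ω) ω

/-- The long-term average reward `ρ^α_θ(x₀)`, an extended real. -/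
def avgReward (M : JumpModel d k q) (N : MarkedPoisson d ε P) (θ : M.Theta)
    (α : ℝ≥0 → Ω → M.Act) (x₀ : Vec d) : EReal :=
  liminf (fun T : ℝ≥0 => (((1 / (T : ℝ)) *
    ∫ ω, (∑ n ∈ Finset.Icc 1 (N.count T ω),
      ε * M.reward (M.stateAt N θ x₀ α n ω) (α (N.τ n ω) ω)) ∂P : ℝ) : EReal)) atTop

/-- The optimal long-term average reward `ρ*_θ(x₀)`. -/
def optReward (M : JumpModel d k q) (N : MarkedPoisson d ε P) (θ : M.Theta) (x₀ : Vec d) : EReal :=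
  ⨆ α ∈ M.controls N, M.avgReward N θ α x₀

/-- `α` is the Markov control generated by the policy `π` from the initial state `x₀`, that is
`α_t = π(X_t)` for all `t`, almost surely, where `X` is the state controlled by `α`. -/
def IsMarkovControl (M : JumpModel d k q) (N : MarkedPoisson d ε P) (θ : M.Theta) (x₀ : Vec d)
    (π : Vec d → M.Act) (α : ℝ≥0 → Ω → M.Act) : Prop :=
  α ∈ M.controls N ∧ ∀ᵐ ω ∂P, ∀ t, α t ω = π (M.state N θ x₀ α t ω)

end JumpModel

end

/-! Run two copies of the controlled walk with the same actions and the same noise. By (A2) their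
`V`-distance shrinks by the factor `1 - ε c` at each step, while the reward `ε r̄` separates two
states by at most `ε L₀ / l` times that distance. The Bellman operator therefore preserves the
functions with increments at most `K * V`, where `K = L₀ / (l c)`: the `ε` cancels, so the Lipschitz
constant `K * L` of the value functions is uniform in `ε` and `θ`. As the discount factor tends to
one, the value functions normalised at the origin are equi-Lipschitz and converge along a
subsequence to some `W`, and the discounted equations converge to the average reward equation with a
constant `g` (`exists_average`).

Verification: under any control, the expected reward of a step is at most `g` minus the expected
increment of `W`, with equality for a maximising action. Summed over the arrivals up to time `T`,
the increments telescope up to a bounded error and leave `g * E[N_T]` (`abs_reward_sub_le`). The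
elementary renewal theorem `tendsto_mean_count` turns this into the average reward `g / ε`.

Two points need care. Controls may depend on the arrival times, so the state at an arrival is not
independent of them; contraction dominates its norm by a function of the marks alone
(`exists_dominating`), whose expectation does factor against the arrival indicators. And the action
at the `n`-th arrival must not see the next mark: up to null events it is determined by the arrival
times and the marks up to `n` (`measurable_past_of_isProgressive`). Finally, the maximiser is chosen
by measurable selection, and its feedback control is shown to be progressive. -/

noncomputable section

/-! ### Discounted and average reward optimality equations -/

/-- A controlled random walk `x ↦ m x a + s z` with rewards `r x a`, such that synchronously coupled
copies contract with respect to `V`. The constant `K` is the resulting modulus of the value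
functions. -/
structure ContractiveDecision (E A Z : Type*) [NormedAddCommGroup E] [TopologicalSpace A]
    [MeasurableSpace Z] (ν : Measure Z) where
  m : E → A → E
  r : E → A → ℝ
  s : Z → E
  V : E → ℝ
  (K L R q κ : ℝ)
  continuous_m : ∀ x, Continuous (m x)
  continuous_r : ∀ x, Continuous (r x)
  integrable_s : Integrable s ν
  abs_r_le : ∀ x a, |r x a| ≤ R
  V_nonneg : ∀ x, 0 ≤ V x
  V_le : ∀ x, V x ≤ L * ‖x‖
  L_nonneg : 0 ≤ L
  K_nonneg : 0 ≤ K
  q_nonneg : 0 ≤ q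
  contract : ∀ x y a, V (m x a - m y a) ≤ q * V (x - y)
  r_sub_le : ∀ x y a, r x a - r y a ≤ κ * V (x - y)
  modulus : K * q + κ ≤ K

namespace ContractiveDecision

variable {E A Z : Type*} [NormedAddCommGroup E] [TopologicalSpace A] [MeasurableSpace Z]
  {ν : Measure Z} [IsProbabilityMeasure ν] (D : ContractiveDecision E A Z ν)

/-- Functions with increments controlled by `K * V`. -/
def Modulus (W : E → ℝ) : Prop := ∀ x y, W x - W y ≤ D.K * D.V (x - y)

/-- The expectation of `W` after a transition. -/
def expect (W : E → ℝ) (x : E) (a : A) : ℝ := ∫ z, W (D.m x a + D.s z) ∂ν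

variable {D} {W : E → ℝ}

namespace Modulus

omit [IsProbabilityMeasure ν] in
lemma abs_sub_le (hW : D.Modulus W) (x y : E) : |W x - W y| ≤ D.K * D.L * ‖x - y‖ := by
  rw [abs_sub_le_iff, mul_assoc]
  constructor
  · exact (hW x y).trans (mul_le_mul_of_nonneg_left (D.V_le _) D.K_nonneg)
  · rw [norm_sub_rev]
    exact (hW y x).trans (mul_le_mul_of_nonneg_left (D.V_le _) D.K_nonneg)

omit [IsProbabilityMeasure ν] in
lemma lipschitzWith (hW : D.Modulus W) : LipschitzWith (D.K * D.L).toNNReal W := by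
  refine LipschitzWith.of_dist_le_mul fun x y => ?_
  rw [Real.coe_toNNReal _ (mul_nonneg D.K_nonneg D.L_nonneg), Real.dist_eq, dist_eq_norm]
  exact hW.abs_sub_le x y

lemma integrable (hW : D.Modulus W) (x : E) : Integrable (fun z => W (x + D.s z)) ν := by
  have h1 : Integrable (fun z => |W x| + D.K * D.L * ‖D.s z‖) ν :=
    (integrable_const _).add (D.integrable_s.norm.const_mul _)
  refine h1.mono' ?_ (Eventually.of_forall fun z => ?_)
  · exact (hW.lipschitzWith.continuous.comp (continuous_const.add continuous_id)).comp_aestronglyMeasurable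
      D.integrable_s.aestronglyMeasurable
  · have := hW.abs_sub_le (x + D.s z) x
    rw [add_sub_cancel_left] at this
    rw [Real.norm_eq_abs]
    have := abs_sub_abs_le_abs_sub (W (x + D.s z)) (W x)
    linarith

lemma abs_integral_sub_le (hW : D.Modulus W) (x y : E) :
    |(∫ z, W (x + D.s z) ∂ν) - ∫ z, W (y + D.s z) ∂ν| ≤ D.K * D.L * ‖x - y‖ := by
  rw [← integral_sub (hW.integrable x) (hW.integrable y), ← Real.norm_eq_abs]
  refine (norm_integral_le_of_norm_le_const (Eventually.of_forall fun z => ?_)).trans_eq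
    (by rw [probReal_univ, mul_one])
  simpa using hW.abs_sub_le (x + D.s z) (y + D.s z)

lemma continuous_integral (hW : D.Modulus W) : Continuous fun x => ∫ z, W (x + D.s z) ∂ν := by
  refine (LipschitzWith.of_dist_le_mul (K := (D.K * D.L).toNNReal) fun x y => ?_).continuous
  rw [Real.coe_toNNReal _ (mul_nonneg D.K_nonneg D.L_nonneg), Real.dist_eq, dist_eq_norm]
  exact hW.abs_integral_sub_le x y

lemma continuous_expect (hW : D.Modulus W) (x : E) : Continuous (D.expect W x) :=
  hW.continuous_integral.comp (D.continuous_m x)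

/-- Synchronous coupling: the same noise drives both copies and cancels in the difference, so only
the contraction of the deterministic part remains. -/
lemma expect_sub_le (hW : D.Modulus W) (x y : E) (a : A) :
    D.expect W x a - D.expect W y a ≤ D.K * D.q * D.V (x - y) := by
  unfold expect
  rw [← integral_sub (hW.integrable _) (hW.integrable _)]
  calc _ ≤ ∫ z, D.K * D.q * D.V (x - y) ∂ν := by
        refine integral_mono ((hW.integrable _).sub (hW.integrable _)) (integrable_const _) fun z => ?_
        refine (hW _ _).trans ?_
        rw [mul_assoc, add_sub_add_right_eq_sub]
        exact mul_le_mul_of_nonneg_left (D.contract x y a) D.K_nonneg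
    _ = _ := by simp

/-- The condition `K * q + κ ≤ K` closes the loop here: reward and continuation value together
reproduce the modulus, for every discount factor up to one. -/
lemma objective_sub_le (hW : D.Modulus W) {γ : ℝ} (h0 : 0 ≤ γ) (h1 : γ ≤ 1) (x y : E) (a : A) :
    (D.r x a + γ * D.expect W x a) - (D.r y a + γ * D.expect W y a) ≤ D.K * D.V (x - y) := by
  have hv := D.V_nonneg (x - y)
  have e := mul_le_mul_of_nonneg_left (hW.expect_sub_le x y a) h0
  have hKq : 0 ≤ D.K * D.q * D.V (x - y) :=
    mul_nonneg (mul_nonneg D.K_nonneg D.q_nonneg) hv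
  have e2 := mul_le_mul_of_nonneg_right h1 hKq
  have e3 := mul_le_mul_of_nonneg_right D.modulus hv
  have e4 := D.r_sub_le x y a
  linarith

end Modulus

variable (D)

/-- The value function of the `γ`-discounted problem. -/
theorem exists_discounted [CompactSpace A] [Nonempty A] {γ : ℝ} (h0 : 0 ≤ γ) (h1 : γ < 1) :
    ∃ W : E → ℝ, D.Modulus W ∧ (∀ x, |W x| ≤ D.R / (1 - γ)) ∧
      ∀ x, IsGreatest (range fun a => D.r x a + γ * D.expect W x a) (W x) := by
  obtain ⟨a₀⟩ := ‹Nonempty A›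
  have hγ : 0 < 1 - γ := by linarith
  set M := D.R / (1 - γ) with hM
  have hMR : D.R + γ * M = M := by rw [hM]; field_simp; ring
  have hR : 0 ≤ D.R := (abs_nonneg _).trans (D.abs_r_le 0 a₀)
  let T : (E → ℝ) → E → ℝ := fun W x => ⨆ a, (D.r x a + γ * D.expect W x a)
  -- The fixed point is the largest subsolution of the Bellman equation, as in Perron's method.
  -- Modulus and bound are built into `S`; the modulus supplies the integrability behind the
  -- monotonicity of `T`, and both survive pointwise suprema.
  let S : Set (E → ℝ) := {W | D.Modulus W ∧ (∀ x, |W x| ≤ M) ∧ ∀ x, W x ≤ T W x}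
  have hbound : ∀ W, (∀ x, |W x| ≤ M) → ∀ x a, |D.r x a + γ * D.expect W x a| ≤ M := by
    intro W hW x a
    have e1 : |D.expect W x a| ≤ M := by
      rw [← Real.norm_eq_abs]
      refine (norm_integral_le_of_norm_le_const (Eventually.of_forall fun z => ?_)).trans_eq
        (by rw [probReal_univ, mul_one])
      exact hW _
    calc _ ≤ |D.r x a| + |γ * D.expect W x a| := abs_add_le _ _
      _ ≤ D.R + γ * M := by
        rw [abs_mul, abs_of_nonneg h0]
        exact add_le_add (D.abs_r_le x a) (mul_le_mul_of_nonneg_left e1 h0)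
      _ = M := hMR
  have hbdd : ∀ W, (∀ x, |W x| ≤ M) → ∀ x, BddAbove (range fun a => D.r x a + γ * D.expect W x a) := by
    rintro W hW x
    exact ⟨M, by rintro _ ⟨a, rfl⟩; exact (abs_le.1 (hbound W hW x a)).2⟩
  have hTmod : ∀ W, D.Modulus W → (∀ x, |W x| ≤ M) → D.Modulus (T W) := by
    intro W hW hb x y
    rw [sub_le_iff_le_add]
    have : Nonempty A := ⟨a₀⟩
    refine ciSup_le fun a => ?_
    have e1 := hW.objective_sub_le h0 h1.le x y a
    have e2 := le_ciSup (hbdd W hb y) a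
    linarith
  have hTb : ∀ W, (∀ x, |W x| ≤ M) → ∀ x, |T W x| ≤ M := by
    intro W hb x
    have : Nonempty A := ⟨a₀⟩
    rw [abs_le]
    exact ⟨(abs_le.1 (hbound W hb x a₀)).1.trans (le_ciSup (hbdd W hb x) a₀),
      ciSup_le fun a => (abs_le.1 (hbound W hb x a)).2⟩
  have hTmono : ∀ W W', D.Modulus W → D.Modulus W' → (∀ x, |W' x| ≤ M) → (∀ x, W x ≤ W' x) →
      ∀ x, T W x ≤ T W' x := by
    intro W W' hW hW' hb hle x
    have : Nonempty A := ⟨a₀⟩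
    refine ciSup_le fun a => le_trans ?_ (le_ciSup (hbdd W' hb x) a)
    have : D.expect W x a ≤ D.expect W' x a :=
      integral_mono (hW.integrable _) (hW'.integrable _) fun z => hle _
    exact add_le_add_right (mul_le_mul_of_nonneg_left this h0) _
  have hM0 : 0 ≤ M := div_nonneg hR hγ.le
  have hSne : (fun _ => -M) ∈ S := by
    refine ⟨fun x y => ?_, fun x => by rw [abs_neg, abs_of_nonneg hM0], fun x => ?_⟩
    · simpa using mul_nonneg D.K_nonneg (D.V_nonneg _)
    · exact (abs_le.1 (hTb (fun _ => -M) (fun x => by rw [abs_neg, abs_of_nonneg hM0]) x)).1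
  have : Nonempty S := ⟨⟨_, hSne⟩⟩
  let U : E → ℝ := fun x => ⨆ W : S, W.1 x
  have hUbdd : ∀ x, BddAbove (range fun W : S => W.1 x) := fun x =>
    ⟨M, by rintro _ ⟨W, rfl⟩; exact (abs_le.1 (W.2.2.1 x)).2⟩
  have hUb : ∀ x, |U x| ≤ M := fun x => abs_le.2
    ⟨le_ciSup (hUbdd x) ⟨_, hSne⟩, ciSup_le fun W => (abs_le.1 (W.2.2.1 x)).2⟩
  have hUmod : D.Modulus U := by
    intro x y
    rw [sub_le_iff_le_add]
    refine ciSup_le fun W => ?_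
    have e1 := W.2.1 x y
    have e2 := le_ciSup (hUbdd y) W
    linarith
  have hUT : ∀ x, U x ≤ T U x := fun x => ciSup_le fun W =>
    (W.2.2.2 x).trans (hTmono W.1 U W.2.1 hUmod hUb (fun y => le_ciSup (hUbdd y) W) x)
  -- `T U` is itself a subsolution in `S`, hence lies below the supremum `U`.
  have hTU : ∀ x, T U x ≤ U x := fun x =>
    le_ciSup (hUbdd x) ⟨T U, hTmod U hUmod hUb, hTb U hUb,
      fun y => hTmono U (T U) hUmod (hTmod U hUmod hUb) (hTb U hUb) hUT y⟩
  refine ⟨U, hUmod, hUb, fun x => ?_⟩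
  have hc : Continuous fun a => D.r x a + γ * D.expect U x a :=
    (D.continuous_r x).add (continuous_const.mul (hUmod.continuous_expect x))
  rw [le_antisymm (hUT x) (hTU x)]
  exact (isCompact_range hc).isGreatest_sSup ⟨_, a₀, rfl⟩

/-- A pointwise relatively compact sequence of equi-Lipschitz functions has a pointwise convergent
subsequence, along which also a given bounded real sequence converges. -/
theorem exists_subseq_tendsto [TopologicalSpace.SeparableSpace E] {C R : ℝ} (hC : 0 ≤ C) (w : ℕ → E → ℝ) (b : ℕ → ℝ)
    (h0 : ∀ n, w n 0 = 0) (hw : ∀ n x y, |w n x - w n y| ≤ C * ‖x - y‖) (hb : ∀ n, |b n| ≤ R) :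
    ∃ (φ : ℕ → ℕ) (W : E → ℝ) (g : ℝ), StrictMono φ ∧ Tendsto (fun n => b (φ n)) atTop (𝓝 g) ∧
      ∀ x, Tendsto (fun n => w (φ n) x) atTop (𝓝 (W x)) := by
  let e := TopologicalSpace.denseSeq E
  -- Values on a countable dense set, together with the scalar `b n`, lie in a compact metrisable
  -- product; this replaces a diagonal extraction.
  let S : Set (ℝ × (ℕ → ℝ)) := Icc (-R) R ×ˢ Set.pi univ fun i => Icc (-(C * ‖e i‖)) (C * ‖e i‖)
  have hS : IsCompact S := isCompact_Icc.prod (isCompact_univ_pi fun i => isCompact_Icc)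
  have hmem : ∀ n, (b n, fun i => w n (e i)) ∈ S := by
    refine fun n => ⟨abs_le.1 (hb n), fun i _ => abs_le.1 ?_⟩
    simpa [h0] using hw n (e i) 0
  obtain ⟨⟨g, v⟩, -, φ, hφ, hlim⟩ := hS.tendsto_subseq hmem
  rw [Prod.tendsto_iff] at hlim
  have hv : ∀ i, Tendsto (fun n => w (φ n) (e i)) atTop (𝓝 (v i)) := fun i =>
    (tendsto_pi_nhds.1 hlim.2) i
  have hcau : ∀ x, ∃ l, Tendsto (fun n => w (φ n) x) atTop (𝓝 l) := by
    intro x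
    refine cauchySeq_tendsto_of_complete (Metric.cauchySeq_iff'.2 fun δ hδ => ?_)
    -- Equicontinuity carries convergence from the dense set to every point. Dividing by `C + 1`
    -- avoids the case `C = 0`.
    obtain ⟨i, hi⟩ : ∃ i, C * ‖x - e i‖ < δ / 3 := by
      obtain ⟨y, hy, i, rfl⟩ := Metric.dense_iff.1 (TopologicalSpace.denseRange_denseSeq E) x (δ / 3 / (C + 1))
        (by positivity)
      refine ⟨i, ?_⟩
      rw [Metric.mem_ball, dist_comm, dist_eq_norm, lt_div_iff₀ (by positivity)] at hy
      nlinarith [norm_nonneg (x - e i)]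
    obtain ⟨N, hN⟩ := Metric.cauchySeq_iff'.1 (hv i).cauchySeq (δ / 3) (by positivity)
    refine ⟨N, fun n hn => ?_⟩
    have h1 := hN n hn
    rw [Real.dist_eq] at h1 ⊢
    have h2 := hw (φ n) x (e i)
    have h3 := hw (φ N) x (e i)
    rw [abs_lt] at h1 ⊢
    rw [abs_le] at h2 h3
    constructor <;> linarith
  choose W hW using hcau
  exact ⟨φ, W, g, hφ, hlim.1, hW⟩

/-- The average reward optimality equation, by vanishing discount. -/
theorem exists_average [TopologicalSpace.SeparableSpace E] {A : Type*} [MetricSpace A] [CompactSpace A] [Nonempty A]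
    (D : ContractiveDecision E A Z ν) :
    ∃ (g : ℝ) (W : E → ℝ), D.Modulus W ∧
      ∀ x, IsGreatest (range fun a => D.expect W x a - W x + D.r x a) g := by
  have hKL := mul_nonneg D.K_nonneg D.L_nonneg
  let γ : ℕ → ℝ := fun n => 1 - 1 / ((n : ℝ) + 1)
  have hγ0 : ∀ n, 0 ≤ γ n := fun n => by
    have : 1 / ((n : ℝ) + 1) ≤ 1 := by rw [div_le_one (by positivity)]; simp
    simp only [γ]; linarith
  have hγ1 : ∀ n, γ n < 1 := fun n => by
    have : 0 < 1 / ((n : ℝ) + 1) := by positivity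
    simp only [γ]; linarith
  have hγlim : Tendsto γ atTop (𝓝 1) := by
    simpa [γ] using (tendsto_const_nhds (x := (1 : ℝ))).sub tendsto_one_div_add_atTop_nhds_zero_nat
  choose U hUmod hUb hU using fun n => D.exists_discounted (hγ0 n) (hγ1 n)
  let w : ℕ → E → ℝ := fun n x => U n x - U n 0
  let b : ℕ → ℝ := fun n => (1 - γ n) * U n 0
  have hwmod : ∀ n, D.Modulus (w n) := fun n x y => by
    simpa [w] using hUmod n x y
  have hb : ∀ n, |b n| ≤ D.R := fun n => by
    have h := hUb n 0
    have h2 : 0 < 1 - γ n := by linarith [hγ1 n]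
    rw [le_div_iff₀ h2] at h
    rw [abs_mul, abs_of_pos h2]; linarith
  obtain ⟨φ, W, g, hφ, hg, hW⟩ := exists_subseq_tendsto hKL w b (fun n => sub_self _)
    (fun n => (hwmod n).abs_sub_le) hb
  have hWmod : D.Modulus W := fun x y =>
    le_of_tendsto ((hW x).sub (hW y)) (Eventually.of_forall fun n => hwmod _ x y)
  have hexp : ∀ u, Tendsto (fun n => ∫ z, w (φ n) (u + D.s z) ∂ν) atTop
      (𝓝 (∫ z, W (u + D.s z) ∂ν)) := by
    intro u
    refine tendsto_integral_of_dominated_convergence (fun z => D.K * D.L * (‖u‖ + ‖D.s z‖))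
      (fun n => ((hwmod _).integrable u).aestronglyMeasurable)
      (((integrable_const _).add D.integrable_s.norm).const_mul _)
      (fun n => Eventually.of_forall fun z => ?_) (Eventually.of_forall fun z => hW _)
    have h := (hwmod (φ n)).abs_sub_le (u + D.s z) 0
    have h0 : w (φ n) 0 = 0 := sub_self _
    rw [h0, sub_zero, sub_zero] at h
    exact h.trans (mul_le_mul_of_nonneg_left (norm_add_le _ _) hKL)
  have hγφ := hγlim.comp hφ.tendsto_atTop
  -- Subtracting `U n 0` from the value function leaves `(1 - γ n) * U n 0` on the other side; this
  -- is the quantity that tends to `g`.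
  have heq : ∀ n x, IsGreatest (range fun a => γ n * D.expect (w n) x a - w n x + D.r x a) (b n) := by
    intro n x
    have hE : ∀ a, D.expect (w n) x a = D.expect (U n) x a - U n 0 := fun a => by
      unfold expect
      simp only [w]
      rw [integral_sub ((hUmod n).integrable _) (integrable_const _)]
      simp
    obtain ⟨⟨a, ha⟩, hle⟩ := hU n x
    refine ⟨⟨a, ?_⟩, ?_⟩
    · simp only [hE, w, b] at ha ⊢; linarith
    · rintro _ ⟨a', rfl⟩
      have := hle ⟨a', rfl⟩
      simp only [hE, w, b] at this ⊢; linarith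
  have hpt : ∀ x a, Tendsto (fun n => γ (φ n) * D.expect (w (φ n)) x a - w (φ n) x + D.r x a) atTop
      (𝓝 (D.expect W x a - W x + D.r x a)) := fun x a => by
    simpa [expect] using ((hγφ.mul (hexp (D.m x a))).sub (hW x)).add_const (D.r x a)
  refine ⟨g, W, hWmod, fun x => ⟨?_, ?_⟩⟩
  -- The maximisers of the discounted problems accumulate at some `a'`. The equi-Lipschitz bound
  -- makes the objective at `a (ψ n)` and at `a'` asymptotically equal, so `a'` attains `g`.
  · choose a ha using fun n => (heq (φ n) x).1
    obtain ⟨a', -, ψ, hψ, haψ⟩ := isCompact_univ.tendsto_subseq (fun n => mem_univ (a n))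
    refine ⟨a', ?_⟩
    have hm := ((D.continuous_m x).tendsto a').comp haψ
    have hr := ((D.continuous_r x).tendsto a').comp haψ
    have hdiff : Tendsto (fun n => D.K * D.L * ‖D.m x (a (ψ n)) - D.m x a'‖ +
        |D.r x (a (ψ n)) - D.r x a'|) atTop (𝓝 0) := by
      have h1 := (hm.sub_const (D.m x a')).norm.const_mul (D.K * D.L)
      have h2 := (hr.sub_const (D.r x a')).abs
      simpa using h1.add h2
    have hlim := (hpt x a').comp hψ.tendsto_atTop
    refine tendsto_nhds_unique hlim ?_
    have hgψ := hg.comp hψ.tendsto_atTop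
    refine hgψ.congr_dist (squeeze_zero (fun _ => dist_nonneg) (fun n => ?_) hdiff)
    simp only [Function.comp]
    rw [← ha (ψ n), Real.dist_eq]
    have e1 := (hwmod (φ (ψ n))).abs_integral_sub_le (D.m x (a (ψ n))) (D.m x a')
    set I := D.expect (w (φ (ψ n))) x (a (ψ n))
    set J := D.expect (w (φ (ψ n))) x a'
    have e2 : |I - J| ≤ D.K * D.L * ‖D.m x (a (ψ n)) - D.m x a'‖ := e1
    have e4 : (γ (φ (ψ n)) * I - w (φ (ψ n)) x + D.r x (a (ψ n))) -
        (γ (φ (ψ n)) * J - w (φ (ψ n)) x + D.r x a') =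
        γ (φ (ψ n)) * (I - J) + (D.r x (a (ψ n)) - D.r x a') := by ring
    rw [e4]
    refine (abs_add_le _ _).trans (add_le_add ?_ le_rfl)
    rw [abs_mul, abs_of_nonneg (hγ0 _)]
    exact (mul_le_of_le_one_left (abs_nonneg _) (hγ1 _).le).trans e2
  · rintro _ ⟨a, rfl⟩
    exact le_of_tendsto_of_tendsto' (hpt x a) hg fun n => (heq (φ n) x).2 ⟨a, rfl⟩

end ContractiveDecision

/-! ### Mean and positivity of the exponential law -/

section Exponential

variable {lam : ℝ}

lemma lintegral_expMeasure (hr : 0 < lam) :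
    ∫⁻ x, ENNReal.ofReal x ∂(expMeasure lam) = ENNReal.ofReal lam⁻¹ := by
  -- Multiplying the exponential density by `x` gives a multiple of the Gamma density of shape two,
  -- whose total mass is known.
  have h : ∀ x, gammaPDF 1 lam x * ENNReal.ofReal x = ENNReal.ofReal lam⁻¹ * gammaPDF 2 lam x := by
    intro x
    rcases lt_or_ge x 0 with hx | hx
    · rw [gammaPDF_of_neg hx, gammaPDF_of_neg hx, zero_mul, mul_zero]
    · rw [gammaPDF_of_nonneg hx, gammaPDF_of_nonneg hx, ← ENNReal.ofReal_mul' hx,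
        ← ENNReal.ofReal_mul (by positivity)]
      congr 1
      have e : (2 : ℝ) - 1 = 1 := by norm_num
      rw [sub_self, e, Real.rpow_zero, Real.rpow_one, Real.rpow_one, Real.Gamma_one,
        Real.Gamma_two, Real.rpow_two]
      field_simp
  have hm : ∀ a, Measurable (gammaPDF a lam) := fun a =>
    (measurable_gammaPDFReal a lam).ennreal_ofReal
  rw [expMeasure, gammaMeasure, lintegral_withDensity_eq_lintegral_mul _ (hm 1)
    ENNReal.measurable_ofReal]
  simp only [Pi.mul_apply]
  simp_rw [h]
  rw [lintegral_const_mul _ (hm 2), lintegral_gammaPDF_eq_one two_pos hr, mul_one]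

lemma expMeasure_Iic_zero (hr : 0 < lam) : expMeasure lam (Iic 0) = 0 := by
  have := isProbabilityMeasure_expMeasure hr
  have h := cdf_expMeasure_eq hr 0
  rw [cdf_eq_real] at h
  simpa [measureReal_eq_zero_iff] using h

lemma ae_pos_expMeasure (hr : 0 < lam) : ∀ᵐ x ∂(expMeasure lam), 0 < x := by
  rw [ae_iff]
  simp only [not_lt]
  exact expMeasure_Iic_zero hr

lemma integrable_id_expMeasure (hr : 0 < lam) : Integrable (fun x => x) (expMeasure lam) := by
  refine ⟨measurable_id.aestronglyMeasurable, ?_⟩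
  rw [hasFiniteIntegral_iff_ofReal ((ae_pos_expMeasure hr).mono fun x hx => hx.le),
    lintegral_expMeasure hr]
  exact ENNReal.ofReal_lt_top

lemma integral_expMeasure (hr : 0 < lam) : ∫ x, x ∂(expMeasure lam) = lam⁻¹ := by
  rw [integral_eq_lintegral_of_nonneg_ae ((ae_pos_expMeasure hr).mono fun x hx => hx.le)
    measurable_id.aestronglyMeasurable, lintegral_expMeasure hr, ENNReal.toReal_ofReal (by positivity)]

end Exponential

/-! ### Renewal theory of the arrival times -/

namespace MarkedPoisson

variable {d : ℕ} {ε : ℝ} {Ω : Type*} [MeasurableSpace Ω] {P : Measure Ω}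
  (N : MarkedPoisson d ε P)

/-- The waiting time after the `n`-th arrival. -/
def gap (n : ℕ) (ω : Ω) : ℝ := (N.τ (n + 1) ω : ℝ) - N.τ n ω

/-- The indicator of `τ n ≤ T`. -/
def arrived (T : ℝ≥0) (n : ℕ) (ω : Ω) : ℝ := if N.τ n ω ≤ T then 1 else 0

/-- The probability of `τ n ≤ T`. -/
def prob (T : ℝ≥0) (n : ℕ) : ℝ := ∫ ω, N.arrived T n ω ∂P

lemma measurable_gap (n : ℕ) : Measurable (N.gap n) :=
  (N.measurable_τ (n + 1)).coe_nnreal_real.sub (N.measurable_τ n).coe_nnreal_real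

lemma measurable_arrived (T : ℝ≥0) (n : ℕ) : Measurable (N.arrived T n) :=
  Measurable.ite (measurableSet_le (N.measurable_τ n) measurable_const) measurable_const
    measurable_const

lemma arrived_nonneg (T : ℝ≥0) (n : ℕ) (ω : Ω) : 0 ≤ N.arrived T n ω := by
  unfold arrived; split_ifs <;> norm_num

lemma arrived_le_one (T : ℝ≥0) (n : ℕ) (ω : Ω) : N.arrived T n ω ≤ 1 := by
  unfold arrived; split_ifs <;> norm_num

lemma abs_arrived_le_one (T : ℝ≥0) (n : ℕ) (ω : Ω) : |N.arrived T n ω| ≤ 1 := by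
  rw [abs_of_nonneg (N.arrived_nonneg T n ω)]; exact N.arrived_le_one T n ω

lemma arrived_zero (T : ℝ≥0) (ω : Ω) : N.arrived T 0 ω = 1 := by
  simp [arrived, N.τ_zero]

lemma integrable_arrived [IsFiniteMeasure P] (T : ℝ≥0) (n : ℕ) : Integrable (N.arrived T n) P :=
  (integrable_const (1 : ℝ)).mono' (N.measurable_arrived T n).aestronglyMeasurable
    (Eventually.of_forall fun ω => N.abs_arrived_le_one T n ω)

lemma prob_nonneg (T : ℝ≥0) (n : ℕ) : 0 ≤ N.prob T n := integral_nonneg (N.arrived_nonneg T n)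

lemma prob_zero [IsProbabilityMeasure P] (T : ℝ≥0) : N.prob T 0 = 1 := by
  simp [prob, arrived_zero]

lemma ae_gap_pos (hε : 0 < ε) : ∀ᵐ ω ∂P, ∀ n, 0 < N.gap n ω := by
  rw [ae_all_iff]
  intro n
  have h := ae_pos_expMeasure (inv_pos.2 hε)
  rw [← (N.law_gap n).map_eq] at h
  exact ae_of_ae_map (N.law_gap n).aemeasurable h

lemma sum_gap (n : ℕ) (ω : Ω) : ∑ k ∈ Finset.range n, N.gap k ω = N.τ n ω := by
  simp only [gap]
  rw [Finset.sum_range_sub (fun k => (N.τ k ω : ℝ)), N.τ_zero]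
  simp

lemma indepFun_τ_gap (n : ℕ) : IndepFun (N.τ n) (N.gap n) P := by
  have h := N.indep_gap.indepFun_finsetSum_of_notMem N.measurable_gap (s := Finset.range n) (i := n)
    Finset.notMem_range_self
  have e : N.τ n = fun ω => ((∑ k ∈ Finset.range n, N.gap k) ω).toNNReal := by
    ext ω
    rw [Finset.sum_apply, N.sum_gap, Real.toNNReal_coe]
  rw [e]
  exact h.comp measurable_real_toNNReal measurable_id

lemma integrable_gap (hε : 0 < ε) (n : ℕ) : Integrable (N.gap n) P := by
  have h := integrable_id_expMeasure (inv_pos.2 hε)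
  rw [← (N.law_gap n).map_eq] at h
  exact h.comp_aemeasurable (N.law_gap n).aemeasurable

/-- The mean of a waiting time capped at `m`. -/
def cappedMean (ε m : ℝ) : ℝ := ∫ x, min x m ∂(expMeasure ε⁻¹)

/-- The mechanism of Wald's identity: whether `τ n ≤ T` is decided by the gaps before the `n`-th,
which are independent of it. -/
lemma integral_arrived_mul (T : ℝ≥0) (n : ℕ) {f : ℝ → ℝ} (hf : Measurable f) :
    ∫ ω, N.arrived T n ω * f (N.gap n ω) ∂P = N.prob T n * ∫ x, f x ∂(expMeasure ε⁻¹) := by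
  have hg : Measurable fun t : ℝ≥0 => if t ≤ T then (1 : ℝ) else 0 :=
    Measurable.ite measurableSet_Iic measurable_const measurable_const
  have h := (N.indepFun_τ_gap n).integral_fun_comp_mul_comp (N.measurable_τ n).aemeasurable
    (N.measurable_gap n).aemeasurable hg.aestronglyMeasurable hf.aestronglyMeasurable
  refine h.trans ?_
  congr 1
  exact (N.law_gap n).integral_comp hf.aestronglyMeasurable

lemma tendsto_cappedMean (hε : 0 < ε) : Tendsto (fun n : ℕ => cappedMean ε n) atTop (𝓝 ε) := by
  have h : ∫ x, x ∂(expMeasure ε⁻¹) = ε := by rw [integral_expMeasure (inv_pos.2 hε), inv_inv]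
  nth_rw 2 [← h]
  refine tendsto_integral_of_dominated_convergence (fun x => |x|) (fun n => by fun_prop)
    (integrable_id_expMeasure (inv_pos.2 hε)).abs (fun n => ?_) ?_
  · filter_upwards [ae_pos_expMeasure (inv_pos.2 hε)] with x hx
    rw [Real.norm_eq_abs, abs_of_nonneg (le_min hx.le n.cast_nonneg), abs_of_pos hx]
    exact min_le_left _ _
  · refine Eventually.of_forall fun x => tendsto_const_nhds.congr' ?_
    filter_upwards [eventually_ge_atTop ⌈x⌉₊] with n hn
    rw [min_eq_left ((Nat.le_ceil x).trans (by exact_mod_cast hn))]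

/-- Only the last gap counted can cross `T`, and capping it at `m` limits the overshoot to `m`. The
bound by `τ n` is carried along for the induction: when `τ n ≤ T` it gives `T + m` after one more
gap. -/
lemma sum_arrived_mul_capped_le {ω : Ω} (h : ∀ n, 0 < N.gap n ω) (T : ℝ≥0) {m : ℝ} (hm : 0 ≤ m)
    (n : ℕ) :
    ∑ k ∈ Finset.range n, N.arrived T k ω * min (N.gap k ω) m ≤ min (N.τ n ω : ℝ) (T + m) := by
  induction n with
  | zero => simpa using add_nonneg T.coe_nonneg hm
  | succ n ih =>
    rw [Finset.sum_range_succ]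
    have hg := h n
    have e : (N.τ (n + 1) ω : ℝ) = N.τ n ω + N.gap n ω := by simp [gap]
    by_cases hT : N.τ n ω ≤ T
    · have hT' : (N.τ n ω : ℝ) ≤ T := hT
      rw [arrived, if_pos hT, one_mul]
      have h1 := ih.trans (min_le_left _ _)
      refine le_min ?_ ?_
      · linarith [min_le_left (N.gap n ω) m]
      · linarith [min_le_right (N.gap n ω) m]
    · rw [arrived, if_neg hT, zero_mul, add_zero]
      exact ih.trans (min_le_min_right _ (by linarith))

/-- The gaps that start by time `T` add up to `τ n`, or else already reach beyond `T`. -/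
lemma le_sum_arrived_mul_gap (ω : Ω) (T : ℝ≥0) (n : ℕ) :
    min (N.τ n ω : ℝ) T ≤ ∑ k ∈ Finset.range n, N.arrived T k ω * N.gap k ω := by
  induction n with
  | zero => simp [N.τ_zero]
  | succ n ih =>
    rw [Finset.sum_range_succ]
    have e : (N.τ (n + 1) ω : ℝ) = N.τ n ω + N.gap n ω := by simp [gap]
    by_cases hT : N.τ n ω ≤ T
    · have hT' : (N.τ n ω : ℝ) ≤ T := hT
      rw [arrived, if_pos hT, one_mul]
      rw [min_eq_left hT'] at ih
      exact (min_le_left _ _).trans (by linarith)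
    · have hT' : (T : ℝ) ≤ N.τ n ω := (not_le.1 hT).le
      rw [arrived, if_neg hT, zero_mul, add_zero]
      rw [min_eq_right hT'] at ih
      exact (min_le_right _ _).trans ih

lemma integrable_arrived_mul (T : ℝ≥0) (n : ℕ) {f : Ω → ℝ} (hf : Integrable f P) :
    Integrable (fun ω => N.arrived T n ω * f ω) P :=
  hf.bdd_mul (N.measurable_arrived T n).aestronglyMeasurable
    (Eventually.of_forall fun ω => N.abs_arrived_le_one T n ω)

variable [IsProbabilityMeasure P]

lemma sum_prob_mul_cappedMean_le (hε : 0 < ε) (T : ℝ≥0) {m : ℝ} (hm : 0 ≤ m) (n : ℕ) :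
    (∑ k ∈ Finset.range n, N.prob T k) * cappedMean ε m ≤ T + m := by
  have hint : ∀ k, Integrable (fun ω => min (N.gap k ω) m) P := fun k =>
    (N.integrable_gap hε k).inf (integrable_const m)
  have e : (∑ k ∈ Finset.range n, N.prob T k) * cappedMean ε m =
      ∫ ω, ∑ k ∈ Finset.range n, N.arrived T k ω * min (N.gap k ω) m ∂P := by
    rw [integral_finsetSum _ fun k _ => N.integrable_arrived_mul T k (hint k), Finset.sum_mul]
    exact Finset.sum_congr rfl fun k _ => (N.integral_arrived_mul T k (by fun_prop)).symm
  rw [e]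
  calc _ ≤ ∫ _, (T + m : ℝ) ∂P := by
        refine integral_mono_ae (integrable_finsetSum _ fun k _ =>
          N.integrable_arrived_mul T k (hint k)) (integrable_const _) ?_
        filter_upwards [N.ae_gap_pos hε] with ω hω
        exact (N.sum_arrived_mul_capped_le hω T hm n).trans (min_le_right _ _)
    _ = _ := by simp

lemma summable_prob (hε : 0 < ε) (T : ℝ≥0) : Summable (N.prob T) := by
  obtain ⟨m, hm⟩ := ((tendsto_cappedMean hε).eventually (lt_mem_nhds hε)).exists
  refine summable_of_sum_range_le (c := (T + m) / cappedMean ε m) (N.prob_nonneg T) fun n => ?_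
  exact (le_div_iff₀ hm).2 (N.sum_prob_mul_cappedMean_le hε T m.cast_nonneg n)

/-- Almost surely the arrival times increase strictly to infinity. -/
lemma ae_regular (hε : 0 < ε) :
    ∀ᵐ ω ∂P, StrictMono (fun n => N.τ n ω) ∧ Tendsto (fun n => N.τ n ω) atTop atTop := by
  -- Borel–Cantelli, using the summability of the probabilities of `τ n ≤ T`.
  have h : ∀ᵐ ω ∂P, ∀ T : ℕ, ∀ᶠ n in atTop, ¬ N.τ n ω ≤ T := by
    rw [ae_all_iff]
    intro T
    refine ae_eventually_notMem (s := fun n => {ω | N.τ n ω ≤ T}) ?_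
    have e : ∀ n, P {ω | N.τ n ω ≤ T} = ENNReal.ofReal (N.prob T n) := fun n => by
      rw [prob, ← ofReal_measureReal, ← integral_indicator_one
        (measurableSet_le (N.measurable_τ n) measurable_const)]
      rfl
    simp_rw [e]
    exact (N.summable_prob hε T).tsum_ofReal_ne_top
  filter_upwards [h, N.ae_gap_pos hε] with ω h1 h2
  refine ⟨strictMono_nat_of_lt_succ fun n => ?_, tendsto_atTop.2 fun b => ?_⟩
  · have := h2 n
    rw [gap, sub_pos] at this
    exact this
  · filter_upwards [h1 ⌈b⌉₊] with n hn
    exact (Nat.le_ceil b).trans (not_le.1 hn).le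

/-- Wald's identity with uncapped gaps: the right-hand side is the mean of the first arrival time
after `T`, which is at least `T`. -/
lemma le_mul_tsum_prob (hε : 0 < ε) (T : ℝ≥0) : (T : ℝ) ≤ ε * ∑' n, N.prob T n := by
  have h1 : Tendsto (fun n => ∫ ω, min (N.τ n ω : ℝ) T ∂P) atTop (𝓝 (∫ _, (T : ℝ) ∂P)) := by
    refine tendsto_integral_of_dominated_convergence (fun _ => (T : ℝ))
      (fun n => ((N.measurable_τ n).coe_nnreal_real.min measurable_const).aestronglyMeasurable)
      (integrable_const _) (fun n => Eventually.of_forall fun ω => ?_) ?_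
    · rw [Real.norm_eq_abs, abs_of_nonneg (le_min (NNReal.coe_nonneg _) T.coe_nonneg)]
      exact min_le_right _ _
    · filter_upwards [N.ae_regular hε] with ω hω
      refine tendsto_const_nhds.congr' ?_
      filter_upwards [hω.2.eventually_ge_atTop T] with n hn
      rw [min_eq_right (by exact_mod_cast hn)]
  have h2 := (N.summable_prob hε T).hasSum.tendsto_sum_nat.const_mul ε
  simp only [integral_const, probReal_univ, one_smul] at h1
  refine le_of_tendsto_of_tendsto' h1 h2 fun n => ?_
  have e : ε * ∑ k ∈ Finset.range n, N.prob T k =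
      ∫ ω, ∑ k ∈ Finset.range n, N.arrived T k ω * N.gap k ω ∂P := by
    rw [integral_finsetSum _ fun k _ => N.integrable_arrived_mul T k (N.integrable_gap hε k),
      mul_comm, Finset.sum_mul]
    refine Finset.sum_congr rfl fun k _ => ?_
    have := N.integral_arrived_mul T k measurable_id
    simp only [id] at this
    rw [this, integral_expMeasure (inv_pos.2 hε), inv_inv]
  rw [e]
  refine integral_mono_ae ?_ (integrable_finsetSum _ fun k _ =>
    N.integrable_arrived_mul T k (N.integrable_gap hε k)) ?_
  · refine (integrable_const (T : ℝ)).mono'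
      ((N.measurable_τ n).coe_nnreal_real.min measurable_const).aestronglyMeasurable
      (Eventually.of_forall fun ω => ?_)
    rw [Real.norm_eq_abs, abs_of_nonneg (le_min (NNReal.coe_nonneg _) T.coe_nonneg)]
    exact min_le_right _ _
  · exact Eventually.of_forall fun ω => N.le_sum_arrived_mul_gap ω T n

/-- The elementary renewal theorem. -/
theorem tendsto_mean_count (hε : 0 < ε) :
    Tendsto (fun T : ℝ≥0 => 1 / (T : ℝ) * ∑' n, N.prob T (n + 1)) atTop (𝓝 ε⁻¹) := by
  have hcast : Tendsto (fun T : ℝ≥0 => (T : ℝ)) atTop atTop := NNReal.tendsto_coe_atTop.2 tendsto_id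
  have hinv : Tendsto (fun T : ℝ≥0 => (T : ℝ)⁻¹) atTop (𝓝 0) := tendsto_inv_atTop_zero.comp hcast
  -- The arrival at time `0` occurs with probability one and is not counted in `N_T`.
  have hsplit : ∀ T : ℝ≥0, ∑' n, N.prob T (n + 1) = ∑' n, N.prob T n - 1 := fun T => by
    rw [(N.summable_prob hε T).tsum_eq_zero_add, N.prob_zero]; ring
  rw [tendsto_order]
  constructor
  · intro a ha
    have h : Tendsto (fun T : ℝ≥0 => ε⁻¹ - (T : ℝ)⁻¹) atTop (𝓝 ε⁻¹) := by
      simpa using (tendsto_const_nhds (x := ε⁻¹)).sub hinv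
    filter_upwards [h.eventually (lt_mem_nhds ha), eventually_gt_atTop 0] with T hT hT0
    refine hT.trans_le ?_
    have hT0' : (0 : ℝ) < T := hT0
    have := N.le_mul_tsum_prob hε T
    rw [hsplit, mul_sub, mul_one, one_div]
    refine sub_le_sub_right ?_ _
    rw [inv_mul_eq_div, le_div_iff₀ hT0', inv_mul_le_iff₀ hε]
    exact this
  · intro a ha
    have h1 : Tendsto (fun n : ℕ => (cappedMean ε n)⁻¹) atTop (𝓝 ε⁻¹) :=
      (tendsto_cappedMean hε).inv₀ hε.ne'
    -- The cap `m` is fixed before `T` grows: the overshoot `m` disappears after division by `T`,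
    -- and the capped mean is already close enough to `ε`.
    obtain ⟨m, hm, hm0⟩ := ((h1.eventually (gt_mem_nhds ha)).and
      ((tendsto_cappedMean hε).eventually (lt_mem_nhds hε))).exists
    have h : Tendsto (fun T : ℝ≥0 => (1 + m * (T : ℝ)⁻¹) * (cappedMean ε m)⁻¹) atTop
        (𝓝 (cappedMean ε m)⁻¹) := by
      simpa using ((tendsto_const_nhds (x := (1 : ℝ))).add (hinv.const_mul (m : ℝ))).mul_const
        (cappedMean ε m)⁻¹
    filter_upwards [h.eventually (gt_mem_nhds hm), eventually_gt_atTop 0] with T hT hT0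
    refine lt_of_le_of_lt ?_ hT
    have hT0' : (0 : ℝ) < T := hT0
    have h2 : ∑' n, N.prob T n ≤ (T + m) / cappedMean ε m :=
      Real.tsum_le_of_sum_range_le (N.prob_nonneg T) fun n =>
        (le_div_iff₀ hm0).2 (N.sum_prob_mul_cappedMean_le hε T m.cast_nonneg n)
    rw [hsplit]
    calc 1 / (T : ℝ) * (∑' n, N.prob T n - 1) ≤ 1 / (T : ℝ) * ((T + m) / cappedMean ε m) := by
          refine mul_le_mul_of_nonneg_left ?_ (by positivity)
          linarith
      _ = _ := by field_simp

end MarkedPoisson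

/-! ### Measurable selection of maximisers -/

/-- A set-valued map with nonempty closed values which hits every closed set measurably. -/
structure MeasurableMulti {X A : Type*} [MeasurableSpace X] [TopologicalSpace A]
    (S : X → Set A) : Prop where
  nonempty : ∀ x, (S x).Nonempty
  isClosed : ∀ x, IsClosed (S x)
  measurable_hit : ∀ C, IsClosed C → MeasurableSet {x | (S x ∩ C).Nonempty}

namespace MeasurableMulti

variable {X A : Type*} [MeasurableSpace X] [MetricSpace A] [CompactSpace A] [Nonempty A]
  [MeasurableSpace A] [BorelSpace A] {S : X → Set A}

omit [BorelSpace A] in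
lemma exists_refine (hS : MeasurableMulti S) {δ : ℝ} (hδ : 0 < δ) :
    ∃ (g : X → A) (S' : X → Set A), Measurable g ∧ MeasurableMulti S' ∧
      ∀ x, S' x ⊆ S x ∧ S' x ⊆ Metric.closedBall (g x) δ := by
  classical
  let e := TopologicalSpace.denseSeq A
  have hex : ∀ x, ∃ i, (S x ∩ Metric.closedBall (e i) δ).Nonempty := fun x => by
    obtain ⟨p, hp⟩ := hS.nonempty x
    obtain ⟨_, hy, i, rfl⟩ := Metric.dense_iff.1 (TopologicalSpace.denseRange_denseSeq A) p δ hδ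
    exact ⟨i, p, hp, Metric.mem_closedBall.2 (by rw [dist_comm]; exact (Metric.mem_ball.1 hy).le)⟩
  -- The first ball of a countable cover that meets `S x`; taking the least index makes the choice
  -- measurable.
  let c : X → ℕ := fun x => Nat.find (hex x)
  have hc : Measurable c := measurable_find hex fun i => hS.measurable_hit _ Metric.isClosed_closedBall
  refine ⟨fun x => e (c x), fun x => S x ∩ Metric.closedBall (e (c x)) δ,
    (measurable_from_nat (f := e)).comp hc, ⟨fun x => Nat.find_spec (hex x),
      fun x => (hS.isClosed x).inter Metric.isClosed_closedBall, fun C hC => ?_⟩,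
    fun x => ⟨inter_subset_left, inter_subset_right⟩⟩
  have h : {x | (S x ∩ Metric.closedBall (e (c x)) δ ∩ C).Nonempty} =
      ⋃ i, c ⁻¹' {i} ∩ {x | (S x ∩ (Metric.closedBall (e i) δ ∩ C)).Nonempty} := by
    ext x
    simp [inter_assoc]
  rw [h]
  exact MeasurableSet.iUnion fun i => (hc (measurableSet_singleton i)).inter
    (hS.measurable_hit _ (Metric.isClosed_closedBall.inter hC))

/-- The Kuratowski–Ryll-Nardzewski selection theorem for a compact target. -/
theorem exists_selection (hS : MeasurableMulti S) : ∃ f : X → A, Measurable f ∧ ∀ x, f x ∈ S x := by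
  have hpos : ∀ n : ℕ, 0 < 1 / ((n : ℝ) + 1) := fun n => by positivity
  choose g nxt hg hnxt hsub using fun (T : {T : X → Set A // MeasurableMulti T}) (n : ℕ) =>
    T.2.exists_refine (hpos n)
  -- Refinements with radii `1 / (n + 1)` are nested and compact, so a point survives in all of
  -- them, and it is the limit of the measurable centres.
  let Q : ℕ → {T : X → Set A // MeasurableMulti T} :=
    fun n => Nat.rec ⟨S, hS⟩ (fun n T => ⟨nxt T n, hnxt T n⟩) n
  have hne : ∀ x, (⋂ n, (Q n).1 x).Nonempty := fun x =>
    IsCompact.nonempty_iInter_of_sequence_nonempty_isCompact_isClosed _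
      (fun n => (hsub (Q n) n x).1) (fun n => (Q n).2.nonempty x)
      ((Q 0).2.isClosed x).isCompact (fun n => (Q n).2.isClosed x)
  choose f hf using hne
  refine ⟨f, measurable_of_tendsto_metrizable (fun n => hg (Q n) n) (tendsto_pi_nhds.2 fun x => ?_),
    fun x => mem_iInter.1 (hf x) 0⟩
  rw [tendsto_iff_dist_tendsto_zero]
  refine squeeze_zero (fun _ => dist_nonneg) (fun n => ?_) tendsto_one_div_add_atTop_nhds_zero_nat
  have h := (hsub (Q n) n x).2 (mem_iInter.1 (hf x) (n + 1))
  rw [dist_comm]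
  exact h

end MeasurableMulti

/-- A continuous function on a product with a compact factor has a measurable maximiser. -/
theorem exists_measurable_argmax {X A : Type*} [TopologicalSpace X] [MeasurableSpace X]
    [OpensMeasurableSpace X] [MetricSpace A] [CompactSpace A] [Nonempty A] [MeasurableSpace A]
    [BorelSpace A] {h : X → A → ℝ} (hh : Continuous (Function.uncurry h)) :
    ∃ f : X → A, Measurable f ∧ ∀ x a, h x a ≤ h x (f x) := by
  have hcl : IsClosed {p : X × A | ∀ a, h p.1 a ≤ h p.1 p.2} := by
    simp only [ofPred_forall]
    exact isClosed_iInter fun a =>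
      isClosed_le (hh.comp (continuous_fst.prodMk continuous_const)) hh
  have hS : MeasurableMulti fun x => {b | ∀ a, h x a ≤ h x b} := by
    refine ⟨fun x => ?_, fun x => hcl.preimage (Continuous.prodMk_right x), fun C hC => ?_⟩
    · obtain ⟨b, -, hb⟩ := isCompact_univ.exists_isMaxOn univ_nonempty
        (hh.comp (Continuous.prodMk_right x)).continuousOn
      exact ⟨b, fun a => hb (mem_univ a)⟩
    -- The hitting set of `C` is the projection of a closed set along the compact factor, hence
    -- closed.
    · have h2 := isClosedMap_fst_of_compactSpace _ (hcl.inter (hC.preimage continuous_snd))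
      refine (congrArg MeasurableSet ?_).mp h2.measurableSet
      ext x
      constructor
      · rintro ⟨⟨_, b⟩, hb, rfl⟩
        exact ⟨b, hb⟩
      · rintro ⟨b, hb⟩
        exact ⟨(x, b), hb, rfl⟩
  exact hS.exists_selection

/-! ### Information available at an arrival -/

lemma ProbabilityTheory.IndepFun.prodMk_left_of_indepFun {Ω α β γ : Type*} [MeasurableSpace Ω]
    [MeasurableSpace α] [MeasurableSpace β] [MeasurableSpace γ] {P : Measure Ω}
    [IsProbabilityMeasure P] {X : Ω → α} {Y : Ω → β} {Z : Ω → γ} (hX : Measurable X)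
    (hY : Measurable Y) (hZ : Measurable Z) (h : IndepFun X (fun ω => (Y ω, Z ω)) P)
    (hYZ : IndepFun Y Z P) : IndepFun (fun ω => (X ω, Y ω)) Z P := by
  rw [indepFun_iff_map_prod_eq_prod_map_map (hX.prodMk hY).aemeasurable hZ.aemeasurable]
  have hXY : IndepFun X Y P := h.comp measurable_id measurable_fst
  have := Measure.isProbabilityMeasure_map (μ := P) hX.aemeasurable
  have := Measure.isProbabilityMeasure_map (μ := P) hY.aemeasurable
  have := Measure.isProbabilityMeasure_map (μ := P) hZ.aemeasurable
  have := Measure.isProbabilityMeasure_map (μ := P) ((hX.prodMk hY).prodMk hZ).aemeasurable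
  refine Measure.ext_prod₃' fun {s t u} hs ht hu => ?_
  rw [Measure.prod_prod, hXY.map_prod_eq_prod_map_map hX.aemeasurable hY.aemeasurable,
    Measure.prod_prod, Measure.map_apply ((hX.prodMk hY).prodMk hZ) ((hs.prod ht).prod hu)]
  have e : (fun ω => ((X ω, Y ω), Z ω)) ⁻¹' ((s ×ˢ t) ×ˢ u) =
      (fun ω => (X ω, Y ω, Z ω)) ⁻¹' (s ×ˢ t ×ˢ u) := by
    ext ω; simp [and_assoc]
  rw [e, ← Measure.map_apply (hX.prodMk (hY.prodMk hZ)) (hs.prod (ht.prod hu)),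
    h.map_prod_eq_prod_map_map hX.aemeasurable (hY.prodMk hZ).aemeasurable, Measure.prod_prod,
    hYZ.map_prod_eq_prod_map_map hY.aemeasurable hZ.aemeasurable, Measure.prod_prod, mul_assoc]

namespace MarkedPoisson

variable {d : ℕ} {ε : ℝ} {Ω : Type*} [mΩ : MeasurableSpace Ω] {P : Measure Ω}
  (N : MarkedPoisson d ε P)

/-- All arrival times, and the marks up to index `n`. -/
def history (n : ℕ) (ω : Ω) : (ℕ → ℝ≥0) × (Finset.range (n + 1) → Vec d) :=
  (fun k => N.τ k ω, fun k => N.ξ k ω)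

/-- The events which are determined by all arrival times and by the marks up to index `n`, up to
null events. -/
@[reducible] def past (n : ℕ) : MeasurableSpace Ω :=
  eventuallyMeasurableSpace (MeasurableSpace.comap (N.history n) inferInstance) (ae P) ⊓ mΩ

lemma measurable_history (n : ℕ) : Measurable (N.history n) :=
  (measurable_pi_lambda _ fun k => N.measurable_τ k).prodMk
    (measurable_pi_lambda _ fun k => N.measurable_ξ k)

lemma past_le (n : ℕ) : N.past n ≤ mΩ := inf_le_right

lemma comap_history_le_past (n : ℕ) :
    MeasurableSpace.comap (N.history n) inferInstance ≤ N.past n :=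
  le_inf le_eventuallyMeasurableSpace (N.measurable_history n).comap_le

lemma measurable_history_past (n : ℕ) : Measurable[N.past n] (N.history n) :=
  Measurable.mono (comap_measurable _) (N.comap_history_le_past n) le_rfl

lemma measurable_τ_past (n k : ℕ) : Measurable[N.past n] (N.τ k) :=
  (measurable_pi_apply k).comp (measurable_fst.comp (N.measurable_history_past n))

lemma measurable_ξ_past {n k : ℕ} (h : k ≤ n) : Measurable[N.past n] (N.ξ k) :=
  (measurable_pi_apply (⟨k, Finset.mem_range.2 (Nat.lt_succ_of_le h)⟩ : Finset.range (n + 1))).comp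
    (measurable_snd.comp (N.measurable_history_past n))

lemma measurableSet_past_of_null (n : ℕ) {s : Set Ω} (hs : MeasurableSet s) (h0 : P s = 0) :
    MeasurableSet[N.past n] s := by
  refine MeasurableSpace.measurableSet_inf.2 ⟨⟨∅, @MeasurableSet.empty _ (_), ?_⟩, hs⟩
  exact ae_eq_empty.2 h0

lemma past_le_succ (n : ℕ) : N.past n ≤ N.past (n + 1) := by
  have h : MeasurableSpace.comap (N.history n) inferInstance ≤
      MeasurableSpace.comap (N.history (n + 1)) inferInstance := by
    let r : (ℕ → ℝ≥0) × (Finset.range (n + 1 + 1) → Vec d) →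
        (ℕ → ℝ≥0) × (Finset.range (n + 1) → Vec d) :=
      fun p => (p.1, fun k => p.2 ⟨k, Finset.range_mono (Nat.le_succ _) k.2⟩)
    have hr : Measurable r := measurable_fst.prodMk
      (measurable_pi_lambda _ fun k => (measurable_pi_apply _).comp measurable_snd)
    have e : N.history n = r ∘ N.history (n + 1) := rfl
    rw [e, ← MeasurableSpace.comap_comp]
    exact MeasurableSpace.comap_mono hr.comap_le
  intro s hs
  obtain ⟨⟨t, ht, hst⟩, hs'⟩ := MeasurableSpace.measurableSet_inf.1 hs
  exact MeasurableSpace.measurableSet_inf.2 ⟨⟨t, h t ht, hst⟩, hs'⟩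

variable [IsProbabilityMeasure P]

lemma indepFun_history (n : ℕ) : IndepFun (N.history n) (N.ξ (n + 1)) P := by
  refine IndepFun.prodMk_left_of_indepFun (measurable_pi_lambda _ fun k => N.measurable_τ k)
    (measurable_pi_lambda _ fun k => N.measurable_ξ k) (N.measurable_ξ (n + 1)) ?_ ?_
  · refine N.indep_τ_ξ.comp measurable_id (ψ := fun v : ℕ → Vec d =>
      ((fun k : Finset.range (n + 1) => v k), v (n + 1))) ?_
    exact (measurable_pi_lambda _ fun k => measurable_pi_apply _).prodMk (measurable_pi_apply _)
  · have h := N.indep_ξ.indepFun_finset (Finset.range (n + 1)) {n + 1} (by simp) N.measurable_ξ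
    exact h.comp measurable_id (measurable_pi_apply (⟨n + 1, by simp⟩ : ({n + 1} : Finset ℕ)))

/-- An event of the past differs by a null event from one determined by the history, and null events
do not affect independence. -/
lemma indepFun_past (n : ℕ) {β : Type*} [MeasurableSpace β] {Y : Ω → β}
    (hY : Measurable[N.past n] Y) : IndepFun Y (N.ξ (n + 1)) P := by
  rw [indepFun_iff_measure_inter_preimage_eq_mul]
  intro s t hs ht
  obtain ⟨⟨_, ⟨A, hA, rfl⟩, hAe⟩, -⟩ := MeasurableSpace.measurableSet_inf.1 (hY hs)
  have h := (indepFun_iff_measure_inter_preimage_eq_mul.1 (N.indepFun_history n)) A t hA ht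
  rw [measure_congr hAe, ← h]
  exact measure_congr (hAe.inter (ae_eq_refl _))

/-- Given the past up to index `n`, the next mark is still standard Gaussian. -/
lemma integral_past (n : ℕ) {β : Type*} [MeasurableSpace β] {Y : Ω → β}
    (hY : Measurable[N.past n] Y) {F : β × Vec d → ℝ} (hF : Measurable F)
    (hint : Integrable (fun ω => F (Y ω, N.ξ (n + 1) ω)) P) :
    Integrable (fun ω => ∫ z, F (Y ω, z) ∂(stdGaussian (Vec d))) P ∧
    ∫ ω, F (Y ω, N.ξ (n + 1) ω) ∂P = ∫ ω, (∫ z, F (Y ω, z) ∂(stdGaussian (Vec d))) ∂P := by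
  have hY' : Measurable Y := hY.mono (N.past_le n) le_rfl
  have hpair : Measurable fun ω => (Y ω, N.ξ (n + 1) ω) := hY'.prodMk (N.measurable_ξ _)
  have hmap := (N.indepFun_past n hY).map_prod_eq_prod_map_map hY'.aemeasurable
    (N.measurable_ξ _).aemeasurable
  rw [(N.law_ξ _).map_eq] at hmap
  have := Measure.isProbabilityMeasure_map (μ := P) hY'.aemeasurable
  have hFint : Integrable F ((P.map Y).prod (stdGaussian (Vec d))) := by
    rw [← hmap, integrable_map_measure hF.aestronglyMeasurable hpair.aemeasurable]
    exact hint
  refine ⟨hFint.integral_prod_left.comp_measurable hY', ?_⟩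
  rw [← integral_map hpair.aemeasurable hF.aestronglyMeasurable (f := F), hmap,
    integral_prod _ hFint, integral_map hY'.aemeasurable]
  exact hF.stronglyMeasurable.integral_prod_right'.aestronglyMeasurable

omit [IsProbabilityMeasure P]

lemma measurableSet_filtration_le (n : ℕ) {u t : ℝ≥0} (h : u ≤ t) {B : Set (Vec d)}
    (hB : MeasurableSet B) : MeasurableSet[N.filtration t] {ω | N.τ n ω ≤ u ∧ N.ξ n ω ∈ B} :=
  MeasurableSpace.measurableSet_generateFrom (Or.inl ⟨n, u, B, h, hB, rfl⟩)

lemma measurableSet_filtration_of_null (t : ℝ≥0) {s : Set Ω} (hs : MeasurableSet s) (h0 : P s = 0) :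
    MeasurableSet[N.filtration t] s :=
  MeasurableSpace.measurableSet_generateFrom (Or.inr ⟨hs, h0⟩)

lemma measurableSet_τ_le (n : ℕ) {u t : ℝ≥0} (h : u ≤ t) :
    MeasurableSet[N.filtration t] {ω | N.τ n ω ≤ u} := by
  simpa using N.measurableSet_filtration_le n h MeasurableSet.univ

/-- At time `t` an arrival is visible only if it has occurred, so `τ n` has to be truncated at `t`.
-/
lemma measurable_min_τ (n : ℕ) (t : ℝ≥0) :
    Measurable[N.filtration t] fun ω => min (N.τ n ω) t := by
  refine measurable_of_Iic (mδ := N.filtration t) fun u => ?_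
  rcases le_or_gt t u with h | h
  · convert! @MeasurableSet.univ Ω (N.filtration t)
    ext ω
    simp [h]
  · convert! N.measurableSet_τ_le n h.le using 1
    ext ω
    simp [not_le.2 h]

/-- Between the `n`-th and the next arrival, no mark beyond the `n`-th has been observed. It
suffices to check this on generators, since the traces on a fixed event of the past form a
σ-algebra. -/
lemma measurableSet_past_inter [IsProbabilityMeasure P] (hε : 0 < ε) (n : ℕ) (t : ℝ≥0) {A : Set Ω}
    (hA : MeasurableSet[N.filtration t] A) :
    MeasurableSet[N.past n] (A ∩ {ω | N.τ n ω ≤ t ∧ t < N.τ (n + 1) ω}) := by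
  set E := {ω | N.τ n ω ≤ t ∧ t < N.τ (n + 1) ω} with hE
  have hEm : MeasurableSet[N.past n] E :=
    (N.measurable_τ_past n n measurableSet_Iic).inter
      (N.measurable_τ_past n (n + 1) measurableSet_Ioi)
  induction A, hA using MeasurableSpace.generateFrom_induction with
  | hC A hA _ =>
    rcases hA with ⟨k, u, B, hu, hB, rfl⟩ | ⟨hA, h0⟩
    · have hτ : MeasurableSet[N.past n] {ω | N.τ k ω ≤ u} :=
        N.measurable_τ_past n k measurableSet_Iic
      rcases le_or_gt k n with hk | hk
      · exact (hτ.inter (N.measurable_ξ_past hk hB)).inter hEm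
      · refine N.measurableSet_past_of_null n ?_ ?_
        -- For `k > n` the trace is null: strictly increasing arrival times give `τ k ≥ τ (n + 1) >
        -- t ≥ u`.
        · exact ((N.past_le n _ hτ).inter (N.measurable_ξ k hB)).inter (N.past_le n _ hEm)
        · refine measure_mono_null (fun ω hω => ?_) (ae_iff.1 (N.ae_regular hε))
          rintro ⟨hmono, -⟩
          have h1 : N.τ (n + 1) ω ≤ N.τ k ω := hmono.monotone hk
          exact absurd (h1.trans (hω.1.1.trans hu)) (not_le.2 hω.2.2)
    · exact N.measurableSet_past_of_null n (hA.inter (N.past_le n _ hEm))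
        (measure_mono_null inter_subset_left h0)
  | empty => simp
  | compl A _ ih =>
    have e : Aᶜ ∩ E = E \ (A ∩ E) := by
      ext ω; simp only [mem_inter_iff, mem_compl_iff, Set.mem_sdiff]; tauto
    rw [e]
    exact hEm.diff ih
  | iUnion A _ ih =>
    rw [iUnion_inter]
    exact MeasurableSet.iUnion ih

/-- A progressive process evaluated at the `n`-th arrival is determined by the past up to index
`n`. -/
lemma measurable_past_of_isProgressive [IsProbabilityMeasure P] (hε : 0 < ε) {β : Type*}
    [MeasurableSpace β] {α : ℝ≥0 → Ω → β} (hα : IsProgressive N.filtration α) (n : ℕ) :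
    Measurable[N.past n] fun ω => α (N.τ n ω) ω := by
  -- Progressive measurability concerns times up to `t` only, so the process is evaluated at `min (τ
  -- n) t`.
  have hmin : ∀ t, Measurable[N.filtration t] fun ω => α (min (N.τ n ω) t) ω := fun t =>
    (hα t).comp (Measurable.prodMk (f := fun ω => (⟨min (N.τ n ω) t, mem_Iic.2 (min_le_right _ _)⟩ : Iic t))
      (Measurable.subtype_mk (N.measurable_min_τ n t)) measurable_id)
  intro C hC
  set B := (fun ω => α (N.τ n ω) ω) ⁻¹' C with hB
  have hBt : ∀ t, MeasurableSet[N.filtration t] (B ∩ {ω | N.τ n ω ≤ t}) := fun t => by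
    have e : B ∩ {ω | N.τ n ω ≤ t} =
        (fun ω => α (min (N.τ n ω) t) ω) ⁻¹' C ∩ {ω | N.τ n ω ≤ t} := by
      ext ω
      refine and_congr_left fun h => ?_
      simp only [hB, mem_preimage]
      rw [min_eq_left h]
    rw [e]
    exact (hmin t hC).inter (N.measurableSet_τ_le n le_rfl)
  have hBm : MeasurableSet B := by
    have e : B = ⋃ m : ℕ, B ∩ {ω | N.τ n ω ≤ m} := by
      ext ω
      simp only [mem_iUnion, mem_inter_iff, mem_ofPred_eq, exists_and_left, iff_self_and]
      exact fun _ => exists_nat_ge _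
    rw [e]
    exact MeasurableSet.iUnion fun m => N.filtration.le _ _ (hBt m)
  let e := TopologicalSpace.denseSeq ℝ≥0
  -- A time from a countable dense set separates `τ n` from `τ (n + 1)`, and at that time the event
  -- is observed with no later mark. The remaining piece, where the arrivals fail to increase, is
  -- null.
  have hsplit : B = (⋃ i, (B ∩ {ω | N.τ n ω ≤ e i}) ∩ {ω | N.τ n ω ≤ e i ∧ e i < N.τ (n + 1) ω}) ∪
      (B ∩ {ω | N.τ (n + 1) ω ≤ N.τ n ω}) := by
    ext ω
    simp only [mem_union, mem_iUnion, mem_inter_iff, mem_ofPred_eq]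
    constructor
    · intro h
      rcases le_or_gt (N.τ (n + 1) ω) (N.τ n ω) with h1 | h1
      · exact Or.inr ⟨h, h1⟩
      · obtain ⟨_, ⟨i, rfl⟩, hi⟩ := (TopologicalSpace.denseRange_denseSeq ℝ≥0).exists_between h1
        exact Or.inl ⟨i, ⟨h, hi.1.le⟩, hi.1.le, hi.2⟩
    · rintro (⟨i, h, -⟩ | h)
      · exact h.1
      · exact h.1
  rw [hsplit]
  refine (MeasurableSet.iUnion fun i => N.measurableSet_past_inter hε n _ (hBt _)).union ?_
  refine N.measurableSet_past_of_null n
    (hBm.inter (measurableSet_le (N.measurable_τ _) (N.measurable_τ _))) ?_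
  refine measure_mono_null (fun ω hω => ?_) (ae_iff.1 (N.ae_regular hε))
  rintro ⟨hmono, -⟩
  exact absurd (hmono (Nat.lt_succ_self n)) (not_lt.2 hω.2)

lemma le_count_iff {ω : Ω} (h : StrictMono (fun n => N.τ n ω) ∧ Tendsto (fun n => N.τ n ω) atTop atTop)
    (t : ℝ≥0) (n : ℕ) : n ≤ N.count t ω ↔ N.τ n ω ≤ t := by
  obtain ⟨hmono, htop⟩ := h
  obtain ⟨m, hm⟩ := (htop.eventually_gt_atTop t).exists
  classical
  set c := Nat.findGreatest (fun k => N.τ k ω ≤ t) m with hc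
  have hle : ∀ k, k ≤ c ↔ N.τ k ω ≤ t := by
    intro k
    constructor
    · intro hk
      have h0 : N.τ c ω ≤ t := Nat.findGreatest_spec (P := fun k => N.τ k ω ≤ t) (Nat.zero_le m)
        (by simp [N.τ_zero])
      exact (hmono.monotone hk).trans h0
    · intro hk
      refine Nat.le_findGreatest ?_ hk
      by_contra hcon
      exact absurd ((hmono.monotone (not_le.1 hcon).le).trans hk) (not_le.2 hm)
  have hset : {k : ℕ | 1 ≤ k ∧ N.τ k ω ≤ t} = (Finset.Icc 1 c : Finset ℕ) := by
    ext k
    simp [hle]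
  have hcount : N.count t ω = c := by
    rw [count, hset, Set.ncard_coe_finset, Nat.card_Icc, Nat.add_sub_cancel]
  rw [hcount]
  exact hle n

lemma count_τ {ω : Ω} (h : StrictMono (fun n => N.τ n ω) ∧ Tendsto (fun n => N.τ n ω) atTop atTop)
    (n : ℕ) : N.count (N.τ n ω) ω = n := by
  refine le_antisymm ?_ ((N.le_count_iff h _ n).2 le_rfl)
  exact h.1.le_iff_le.1 ((N.le_count_iff h _ _).1 le_rfl)

end MarkedPoisson

/-! ### Feedback controls generated by policies -/

namespace JumpModel

variable {d k q : ℕ} (M : JumpModel d k q) {ε : ℝ} {Ω : Type*} [mΩ : MeasurableSpace Ω]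
  {P : Measure Ω} (N : MarkedPoisson d ε P) (θ : M.Theta)

lemma continuous_step (ε : ℝ)
    (hdrift : Continuous fun p : Vec d × M.Act => M.drift θ p.1 p.2) :
    Continuous fun p : Vec d × M.Act × Vec d => M.step ε θ p.1 p.2.1 p.2.2 := by
  have h : Continuous fun p : Vec d × M.Act × Vec d => M.drift θ p.1 p.2.1 :=
    hdrift.comp (continuous_fst.prodMk (continuous_fst.comp continuous_snd))
  unfold step
  fun_prop

/-- The state at the `n`-th arrival under the policy `π`, as a function of the marks. -/
def chain (ε : ℝ) (x₀ : Vec d) (π : Vec d → M.Act) (ζ : ℕ → Vec d) : ℕ → Vec d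
  | 0 => x₀
  | n + 1 => M.step ε θ (chain ε x₀ π ζ n) (π (chain ε x₀ π ζ n)) (ζ (n + 1))

lemma chain_congr (ε : ℝ) (x₀ : Vec d) (π : Vec d → M.Act) {ζ ζ' : ℕ → Vec d} {n : ℕ}
    (h : ∀ i ≤ n, ζ i = ζ' i) : M.chain θ ε x₀ π ζ n = M.chain θ ε x₀ π ζ' n := by
  induction n with
  | zero => rfl
  | succ n ih =>
    simp only [chain]
    rw [ih fun i hi => h i (hi.trans (Nat.le_succ n)), h (n + 1) le_rfl]

lemma measurable_chain (hdrift : Continuous fun p : Vec d × M.Act => M.drift θ p.1 p.2) (ε : ℝ)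
    (x₀ : Vec d) {π : Vec d → M.Act} (hπ : Measurable π) {X : Type*} [MeasurableSpace X]
    {ζ : ℕ → X → Vec d} (hζ : ∀ n, Measurable (ζ n)) (n : ℕ) :
    Measurable fun ω => M.chain θ ε x₀ π (fun k => ζ k ω) n := by
  induction n with
  | zero => exact measurable_const
  | succ n ih =>
    exact (M.continuous_step θ ε hdrift).measurable.comp
      (ih.prodMk ((hπ.comp ih).prodMk (hζ (n + 1))))

/-- A measurable policy generates a Markov control. -/
theorem exists_isMarkovControl [IsProbabilityMeasure P] (hε : 0 < ε) (hne : M.Act.Nonempty)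
    (hdrift : Continuous fun p : Vec d × M.Act => M.drift θ p.1 p.2) {π : Vec d → M.Act}
    (hπ : Measurable π) (x₀ : Vec d) : ∃ α, M.IsMarkovControl N θ x₀ π α := by
  classical
  obtain ⟨a₀⟩ : Nonempty M.Act := hne.to_subtype
  -- A measurable null set containing all irregular paths; the augmentation places it in every
  -- `N.filtration t`, so the control may be reset to `a₀` on it.
  set Gc := toMeasurable P {ω | ¬ (StrictMono (fun n => N.τ n ω) ∧
    Tendsto (fun n => N.τ n ω) atTop atTop)} with hGc
  have hGm : MeasurableSet Gc := measurableSet_toMeasurable _ _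
  have hG0 : P Gc = 0 := by rw [hGc, measure_toMeasurable]; exact ae_iff.1 (N.ae_regular hε)
  have hG : ∀ ω, ω ∉ Gc → StrictMono (fun n => N.τ n ω) ∧
      Tendsto (fun n => N.τ n ω) atTop atTop := fun ω hω => by
    by_contra hcon
    exact hω (subset_toMeasurable _ _ hcon)
  let Y : ℕ → Ω → Vec d := fun n ω => M.chain θ ε x₀ π (fun i => N.ξ i ω) n
  let α : ℝ≥0 → Ω → M.Act := fun t ω => if ω ∈ Gc then a₀ else π (Y (N.count t ω) ω)
  have hY : ∀ (t : ℝ≥0) (n : ℕ) (D : Set (Vec d)), MeasurableSet D →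
      MeasurableSet[N.filtration t] ((Gcᶜ ∩ {ω | N.τ n ω ≤ t}) ∩ Y n ⁻¹' D) := by
    intro t n D hD
    -- Marks not yet observed at time `t` are replaced by `0`. The modified chain is observable at
    -- time `t` and agrees with `Y n` on the regular paths with `τ n ≤ t`.
    let ζ : ℕ → Ω → Vec d := fun i ω => if N.τ i ω ≤ t then N.ξ i ω else 0
    have hζ : ∀ i, Measurable[N.filtration t] (ζ i) := fun i B hB => by
      have hτ := N.measurableSet_τ_le i (le_refl t)
      have e : ζ i ⁻¹' B = {ω | N.τ i ω ≤ t ∧ N.ξ i ω ∈ B} ∪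
          ({ω | N.τ i ω ≤ t}ᶜ ∩ {_ω : Ω | (0 : Vec d) ∈ B}) := by
        ext ω
        by_cases h : N.τ i ω ≤ t <;> simp [ζ, h]
      rw [e]
      exact (N.measurableSet_filtration_le i le_rfl hB).union
        (hτ.compl.inter (@MeasurableSet.const _ (N.filtration t) _))
    have hZ := @measurable_chain d k q M θ hdrift ε x₀ π hπ Ω (N.filtration t) ζ hζ n
    have e : (Gcᶜ ∩ {ω | N.τ n ω ≤ t}) ∩ Y n ⁻¹' D = (Gcᶜ ∩ {ω | N.τ n ω ≤ t}) ∩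
        (fun ω => M.chain θ ε x₀ π (fun i => ζ i ω) n) ⁻¹' D := by
      ext ω
      refine and_congr_right fun h => ?_
      have h2 : Y n ω = M.chain θ ε x₀ π (fun i => ζ i ω) n :=
        M.chain_congr θ ε x₀ π fun i hi => by
          simp only [ζ]
          rw [if_pos (((hG ω h.1).1.monotone hi).trans h.2)]
      simp only [mem_preimage, h2]
    rw [e]
    exact ((N.measurableSet_filtration_of_null t hGm hG0).compl.inter
      (N.measurableSet_τ_le n le_rfl)).inter (hZ hD)
  have hprog : IsProgressive N.filtration α := by
    intro t C hC
    have hle : ∀ n, MeasurableSet[Subtype.instMeasurableSpace.prod (N.filtration t)]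
        {p : Iic t × Ω | min (N.τ n p.2) t ≤ p.1} := fun n =>
      measurableSet_le (mδ := Subtype.instMeasurableSpace.prod (N.filtration t))
        (@Measurable.comp _ _ _ (Subtype.instMeasurableSpace.prod (N.filtration t))
          (N.filtration t) _ _ _ (N.measurable_min_τ n t) (@measurable_snd _ _ _ (N.filtration t)))
        (@Measurable.comp _ _ _ (Subtype.instMeasurableSpace.prod (N.filtration t)) _ _ _ _
          measurable_subtype_coe (@measurable_fst _ _ _ (N.filtration t)))
    have hpre : ∀ s, MeasurableSet[N.filtration t] s →
        MeasurableSet[Subtype.instMeasurableSpace.prod (N.filtration t)]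
          {p : Iic t × Ω | p.2 ∈ s} := fun s hs => @measurable_snd _ _ _ (N.filtration t) s hs
    -- Decomposition by the number of arrivals up to the running time `s ≤ t`, with `τ n ≤ s`
    -- written through events observable at time `t`.
    have e : (fun p : Iic t × Ω => α p.1 p.2) ⁻¹' C =
        ({p : Iic t × Ω | p.2 ∈ Gc} ∩ {p : Iic t × Ω | p.2 ∈ {_ω : Ω | a₀ ∈ C}}) ∪
        ⋃ n, {p : Iic t × Ω | p.2 ∈ (Gcᶜ ∩ {ω | N.τ n ω ≤ t}) ∩ Y n ⁻¹' (π ⁻¹' C)} ∩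
          ({p : Iic t × Ω | min (N.τ n p.2) t ≤ p.1} \
            ({p : Iic t × Ω | p.2 ∈ {ω | N.τ (n + 1) ω ≤ t}} ∩
              {p : Iic t × Ω | min (N.τ (n + 1) p.2) t ≤ p.1})) := by
      ext ⟨⟨s, hs⟩, ω⟩
      have hs' : s ≤ t := hs
      by_cases hω : ω ∈ Gc
      · simp [α, hω]
      · have hcount : ∀ n, N.count s ω = n ↔ N.τ n ω ≤ s ∧ ¬ N.τ (n + 1) ω ≤ s := fun n => by
          rw [← N.le_count_iff (hG ω hω), ← N.le_count_iff (hG ω hω)]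
          omega
        have hmin : ∀ n, N.τ n ω ≤ s ↔ N.τ n ω ≤ t ∧ min (N.τ n ω) t ≤ s := fun n =>
          ⟨fun h => ⟨h.trans hs', (min_le_left _ _).trans h⟩, fun h => by
            have h2 := h.2
            rwa [min_eq_left h.1] at h2⟩
        have h1 : α s ω ∈ C ↔ ∃ n, N.count s ω = n ∧ π (Y n ω) ∈ C := by simp [α, hω]
        simp only [mem_preimage, h1, hcount, hmin, mem_union, mem_inter_iff, mem_ofPred_eq, hω,
          false_and, false_or, mem_iUnion, Set.mem_sdiff, mem_compl_iff, not_false_eq_true, true_and]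
        exact exists_congr fun n => by tauto
    rw [e]
    exact ((hpre _ (N.measurableSet_filtration_of_null t hGm hG0)).inter
      (hpre _ (@MeasurableSet.const _ (N.filtration t) _))).union (MeasurableSet.iUnion fun n =>
        (hpre _ (hY t n _ (hπ hC))).inter ((hle n).diff
          ((hpre _ (N.measurableSet_τ_le (n + 1) le_rfl)).inter (hle (n + 1)))))
  refine ⟨α, hprog, ?_⟩
  have hGae : ∀ᵐ ω ∂P, ω ∉ Gc := measure_eq_zero_iff_ae_notMem.1 hG0
  filter_upwards [hGae] with ω hω t
  -- Consistency: `α` was built from the chain `Y`, and because the count at `τ n` equals `n`, the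
  -- state controlled by `α` is `Y` itself.
  have hst : ∀ n, M.stateAt N θ x₀ α n ω = Y n ω := by
    intro n
    induction n with
    | zero => rfl
    | succ n ih =>
      simp only [stateAt, Y, chain]
      rw [ih]
      simp only [α, if_neg hω, N.count_τ (hG ω hω)]
      rfl
  simp only [state, hst]
  simp only [α, if_neg hω]

end JumpModel

/-! ### Summation by parts and bounds independent of the arrival times -/

namespace MarkedPoisson

variable {d : ℕ} {ε : ℝ} {Ω : Type*} [mΩ : MeasurableSpace Ω] {P : Measure Ω}
  (N : MarkedPoisson d ε P) [IsProbabilityMeasure P]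

omit [IsProbabilityMeasure P] in
lemma integral_arrived_mul_of_indepFun {B : Ω → ℝ} (hB : Integrable B P) {n : ℕ}
    (hind : IndepFun (N.τ n) B P) (T : ℝ≥0) :
    ∫ ω, N.arrived T n ω * B ω ∂P = N.prob T n * ∫ ω, B ω ∂P := by
  have hg : Measurable fun t : ℝ≥0 => if t ≤ T then (1 : ℝ) else 0 :=
    Measurable.ite measurableSet_Iic measurable_const measurable_const
  exact (hind.comp hg measurable_id).integral_fun_mul_eq_mul_integral
    (N.measurable_arrived T n).aestronglyMeasurable hB.aestronglyMeasurable

lemma arrived_succ_le (hε : 0 < ε) (T : ℝ≥0) (n : ℕ) :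
    ∀ᵐ ω ∂P, N.arrived T (n + 1) ω ≤ N.arrived T n ω := by
  filter_upwards [N.ae_regular hε] with ω hω
  unfold arrived
  have h : N.τ n ω ≤ N.τ (n + 1) ω := hω.1.monotone n.le_succ
  split_ifs with h1 h2
  · exact le_rfl
  · exact absurd (h.trans h1) h2
  · exact zero_le_one
  · exact le_rfl

/-- Summation by parts: the expected increments up to time `T` of a process dominated by variables
independent of the arrival times telescope to a bounded quantity. -/
lemma abs_sum_increments_le (hε : 0 < ε) {w B : ℕ → Ω → ℝ} {b : ℝ}
    (hw : ∀ n, AEStronglyMeasurable (w n) P) (hB : ∀ n, Integrable (B n) P)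
    (hle : ∀ n ω, |w n ω| ≤ B n ω) (hind : ∀ k n, IndepFun (N.τ k) (B n) P)
    (hb : ∀ n, ∫ ω, B n ω ∂P ≤ b) (T : ℝ≥0) (m : ℕ) :
    |∑ n ∈ Finset.range m, ((∫ ω, N.arrived T (n + 1) ω * w (n + 2) ω ∂P) -
      ∫ ω, N.arrived T (n + 1) ω * w (n + 1) ω ∂P)| ≤ 2 * b := by
  have hwint : ∀ n, Integrable (w n) P := fun n =>
    (hB n).mono' (hw n) (Eventually.of_forall fun ω => hle n ω)
  have hI : ∀ i j, |∫ ω, N.arrived T i ω * w j ω ∂P| ≤ N.prob T i * b := by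
    intro i j
    rw [← Real.norm_eq_abs]
    calc _ ≤ ∫ ω, N.arrived T i ω * B j ω ∂P := by
          refine norm_integral_le_of_norm_le (N.integrable_arrived_mul T i (hB j))
            (Eventually.of_forall fun ω => ?_)
          rw [Real.norm_eq_abs, abs_mul, abs_of_nonneg (N.arrived_nonneg T i ω)]
          exact mul_le_mul_of_nonneg_left (hle j ω) (N.arrived_nonneg T i ω)
      _ = N.prob T i * ∫ ω, B j ω ∂P := N.integral_arrived_mul_of_indepFun (hB j) (hind i j) T
      _ ≤ _ := mul_le_mul_of_nonneg_left (hb j) (N.prob_nonneg T i)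
  have hD : ∀ i j, |(∫ ω, N.arrived T i ω * w j ω ∂P) - ∫ ω, N.arrived T (i + 1) ω * w j ω ∂P| ≤
      (N.prob T i - N.prob T (i + 1)) * b := by
    intro i j
    rw [← integral_sub (N.integrable_arrived_mul T i (hwint j))
      (N.integrable_arrived_mul T (i + 1) (hwint j)), ← Real.norm_eq_abs]
    have hmono : N.prob T (i + 1) ≤ N.prob T i :=
      integral_mono_ae (N.integrable_arrived T _) (N.integrable_arrived T _)
        (N.arrived_succ_le hε T i)
    calc _ ≤ ∫ ω, (N.arrived T i ω * B j ω - N.arrived T (i + 1) ω * B j ω) ∂P := by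
          refine norm_integral_le_of_norm_le ((N.integrable_arrived_mul T i (hB j)).sub
            (N.integrable_arrived_mul T (i + 1) (hB j))) ?_
          filter_upwards [N.arrived_succ_le hε T i] with ω hω
          rw [← sub_mul, ← sub_mul, Real.norm_eq_abs, abs_mul, abs_of_nonneg (sub_nonneg.2 hω)]
          exact mul_le_mul_of_nonneg_left (hle j ω) (sub_nonneg.2 hω)
      _ = (N.prob T i - N.prob T (i + 1)) * ∫ ω, B j ω ∂P := by
          rw [integral_sub (N.integrable_arrived_mul T i (hB j))
            (N.integrable_arrived_mul T (i + 1) (hB j)),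
            N.integral_arrived_mul_of_indepFun (hB j) (hind i j),
            N.integral_arrived_mul_of_indepFun (hB j) (hind (i + 1) j), sub_mul]
      _ ≤ _ := mul_le_mul_of_nonneg_left (hb j) (sub_nonneg.2 hmono)
  -- After removal of the boundary term, each step adds at most `(prob T m - prob T (m + 1)) * b`,
  -- since the indicators decrease in `n`. With the initial term these sum to `(2 - prob T m) * b`;
  -- the boundary term costs the missing `prob T m * b`.
  have hS : ∀ m, |(∑ n ∈ Finset.range m, ((∫ ω, N.arrived T (n + 1) ω * w (n + 2) ω ∂P) -
      ∫ ω, N.arrived T (n + 1) ω * w (n + 1) ω ∂P)) - ∫ ω, N.arrived T m ω * w (m + 1) ω ∂P| ≤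
      (2 - N.prob T m) * b := by
    intro m
    induction m with
    | zero =>
      have := hI 0 1
      rw [N.prob_zero] at this ⊢
      rw [Finset.sum_range_zero, zero_sub, abs_neg]
      exact this.trans_eq (by ring)
    | succ m ih =>
      rw [Finset.sum_range_succ]
      have h2 := hD m (m + 1)
      rw [abs_le] at ih h2 ⊢
      constructor <;> linarith [ih.1, ih.2, h2.1, h2.2]
  have h1 := hS m
  have h2 := hI m (m + 1)
  rw [abs_le] at h1 h2 ⊢
  constructor <;> linarith [h1.1, h1.2, h2.1, h2.2]

/-- The solution of `z (n + 1) = q * z n + e (n + 1)` with `z 0 = v`. -/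
def linRec (q v : ℝ) (e : ℕ → ℝ) : ℕ → ℝ
  | 0 => v
  | n + 1 => q * linRec q v e n + e (n + 1)

/-- The solution of a stable linear recursion driven by a function of the marks is bounded in mean
and independent of the arrival times. -/
lemma linRec_marks {q v b : ℝ} {f : Vec d → ℝ} (hf : Measurable f)
    (hfi : Integrable f (stdGaussian (Vec d))) (hq : 0 ≤ q) (hv : v ≤ b)
    (hb : q * b + ∫ z, f z ∂(stdGaussian (Vec d)) ≤ b) (n : ℕ) :
    Integrable (fun ω => linRec q v (fun i => f (N.ξ i ω)) n) P ∧
    (∫ ω, linRec q v (fun i => f (N.ξ i ω)) n ∂P ≤ b) ∧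
    ∀ i, IndepFun (N.τ i) (fun ω => linRec q v (fun i => f (N.ξ i ω)) n) P := by
  have hmeas : ∀ n, Measurable fun ζ : ℕ → Vec d => linRec q v (fun i => f (ζ i)) n := by
    intro n
    induction n with
    | zero => exact measurable_const
    | succ n ih => exact (ih.const_mul q).add (hf.comp (measurable_pi_apply _))
  have hfξ : ∀ n, Integrable (fun ω => f (N.ξ n ω)) P := fun n => by
    rw [← (N.law_ξ n).map_eq] at hfi
    exact hfi.comp_measurable (N.measurable_ξ n)
  have hmain : ∀ n, Integrable (fun ω => linRec q v (fun i => f (N.ξ i ω)) n) P ∧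
      (∫ ω, linRec q v (fun i => f (N.ξ i ω)) n ∂P ≤ b) := by
    intro n
    induction n with
    | zero => exact ⟨integrable_const v, by simpa [linRec] using hv⟩
    | succ n ih =>
      refine ⟨(ih.1.const_mul q).add (hfξ (n + 1)), ?_⟩
      simp only [linRec]
      rw [integral_add (ih.1.const_mul q) (hfξ (n + 1)), integral_const_mul]
      have h : ∫ ω, f (N.ξ (n + 1) ω) ∂P = ∫ z, f z ∂(stdGaussian (Vec d)) :=
        (N.law_ξ (n + 1)).integral_comp hf.aestronglyMeasurable
      rw [h]
      linarith [mul_le_mul_of_nonneg_left ih.2 hq]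
  exact ⟨(hmain n).1, (hmain n).2, fun i => N.indep_τ_ξ.comp (measurable_pi_apply i) (hmeas n)⟩

end MarkedPoisson

/-! ### Verification: rewards in terms of the Hamiltonian -/

namespace JumpModel

variable {d k q : ℕ} (M : JumpModel d k q) {ε : ℝ} {Ω : Type*} [mΩ : MeasurableSpace Ω]
  {P : Measure Ω} [IsProbabilityMeasure P] (N : MarkedPoisson d ε P) (θ : M.Theta)

lemma measurable_stateAt (hε : 0 < ε)
    (hdrift : Continuous fun p : Vec d × M.Act => M.drift θ p.1 p.2) (x₀ : Vec d)
    {α : ℝ≥0 → Ω → M.Act} (hα : α ∈ M.controls N) (n : ℕ) :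
    Measurable[N.past n] (M.stateAt N θ x₀ α n) := by
  induction n with
  | zero => exact @measurable_const _ _ _ (N.past 0) x₀
  | succ n ih =>
    have h1 : Measurable[N.past (n + 1)] fun ω =>
        (M.stateAt N θ x₀ α n ω, α (N.τ n ω) ω, N.ξ (n + 1) ω) :=
      (ih.mono (N.past_le_succ n) le_rfl).prodMk
        (((N.measurable_past_of_isProgressive hε hα n).mono (N.past_le_succ n) le_rfl).prodMk
          (N.measurable_ξ_past le_rfl))
    exact (M.continuous_step θ ε hdrift).measurable.comp h1

/-- The expected reward up to time `T` in terms of the Hamiltonian of a Lipschitz function. -/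
theorem abs_reward_sub_le (hε : 0 < ε)
    (hdrift : Continuous fun p : Vec d × M.Act => M.drift θ p.1 p.2)
    (hrew : Continuous fun p : Vec d × M.Act => M.reward p.1 p.2)
    {R : ℝ} (hR : ∀ x a, |M.reward x a| ≤ R) {W : Vec d → ℝ} {C : ℝ≥0} (hW : LipschitzWith C W)
    (x₀ : Vec d) {α : ℝ≥0 → Ω → M.Act} (hα : α ∈ M.controls N) {B : ℕ → Ω → ℝ} {b : ℝ}
    (hB : ∀ n, Integrable (B n) P) (hle : ∀ n ω, ‖M.stateAt N θ x₀ α n ω‖ ≤ B n ω)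
    (hind : ∀ k n, IndepFun (N.τ k) (B n) P) (hb : ∀ n, ∫ ω, B n ω ∂P ≤ b) (T : ℝ≥0) (g : ℝ) :
    ((∀ x a, M.hamiltonian ε θ W x a ≤ g) →
      ∫ ω, (∑ n ∈ Finset.Icc 1 (N.count T ω),
        ε * M.reward (M.stateAt N θ x₀ α n ω) (α (N.τ n ω) ω)) ∂P ≤
        g * ∑' n, N.prob T (n + 1) + 2 * (|W 0| + C * b)) ∧
    ((∀ᵐ ω ∂P, ∀ n, M.hamiltonian ε θ W (M.stateAt N θ x₀ α n ω) (α (N.τ n ω) ω) = g) →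
      g * ∑' n, N.prob T (n + 1) - 2 * (|W 0| + C * b) ≤
      ∫ ω, (∑ n ∈ Finset.Icc 1 (N.count T ω),
        ε * M.reward (M.stateAt N θ x₀ α n ω) (α (N.τ n ω) ω)) ∂P) := by
  set X := M.stateAt N θ x₀ α
  set A : ℕ → Ω → M.Act := fun n ω => α (N.τ n ω) ω
  have hXp : ∀ n, Measurable[N.past n] (X n) := M.measurable_stateAt N θ hε hdrift x₀ hα
  have hAp : ∀ n, Measurable[N.past n] (A n) := N.measurable_past_of_isProgressive hε hα
  have hX : ∀ n, Measurable (X n) := fun n => (hXp n).mono (N.past_le n) le_rfl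
  have hA : ∀ n, Measurable (A n) := fun n => (hAp n).mono (N.past_le n) le_rfl
  have hWle : ∀ x y, |W x - W y| ≤ C * ‖x - y‖ := fun x y => by
    simpa [Real.dist_eq, dist_eq_norm] using hW.dist_le_mul x y
  have hWabs : ∀ n ω, |W (X n ω)| ≤ |W 0| + C * B n ω := fun n ω => by
    have h1 := hWle (X n ω) 0
    rw [sub_zero] at h1
    have h2 := abs_sub_abs_le_abs_sub (W (X n ω)) (W 0)
    have h3 := mul_le_mul_of_nonneg_left (hle n ω) C.coe_nonneg
    linarith
  have hB' : ∀ n, Integrable (fun ω => |W 0| + C * B n ω) P := fun n =>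
    (integrable_const _).add ((hB n).const_mul _)
  have hWX : ∀ n, Integrable (fun ω => W (X n ω)) P := fun n =>
    (hB' n).mono' (hW.continuous.measurable.comp (hX n)).aestronglyMeasurable
      (Eventually.of_forall fun ω => hWabs n ω)
  have hRint : ∀ n, Integrable (fun ω => ε * M.reward (X n ω) (A n ω)) P := fun n =>
    (integrable_const (ε * R)).mono'
      ((hrew.measurable.comp ((hX n).prodMk (hA n))).const_mul ε).aestronglyMeasurable
      (Eventually.of_forall fun ω => by
        rw [Real.norm_eq_abs, abs_mul, abs_of_pos hε]
        exact mul_le_mul_of_nonneg_left (hR _ _) hε.le)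
  have hincr := N.abs_sum_increments_le hε (w := fun n ω => W (X n ω))
    (B := fun n ω => |W 0| + C * B n ω) (b := |W 0| + C * b)
    (fun n => (hWX n).aestronglyMeasurable) hB' hWabs
    (fun i n => (hind i n).comp measurable_id (measurable_id.const_mul (C : ℝ) |>.const_add |W 0|))
    (fun n => by
      rw [integral_add (integrable_const _) ((hB n).const_mul _), integral_const_mul]
      simpa using mul_le_mul_of_nonneg_left (hb n) C.coe_nonneg) T
  have hstep : ∀ n, Integrable (fun ω => N.arrived T n ω * M.hamiltonian ε θ W (X n ω) (A n ω)) P ∧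
      ∫ ω, N.arrived T n ω * (ε * M.reward (X n ω) (A n ω)) ∂P =
      (∫ ω, N.arrived T n ω * M.hamiltonian ε θ W (X n ω) (A n ω) ∂P) -
      ((∫ ω, N.arrived T n ω * W (X (n + 1) ω) ∂P) - ∫ ω, N.arrived T n ω * W (X n ω) ∂P) := by
    intro n
    -- The indicator of `τ n ≤ T` belongs to the past, so averaging over the next mark turns the
    -- increment of `W` plus the reward into the Hamiltonian.
    let F : (ℝ × Vec d × M.Act) × Vec d → ℝ := fun p =>
      p.1.1 * (W (M.step ε θ p.1.2.1 p.1.2.2 p.2) - W p.1.2.1 + ε * M.reward p.1.2.1 p.1.2.2)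
    have hF : Measurable F := by
      have hfst : Measurable fun p : (ℝ × Vec d × M.Act) × Vec d => p.1.2 :=
        measurable_snd.comp measurable_fst
      have h1 : Measurable fun p : (ℝ × Vec d × M.Act) × Vec d =>
          M.step ε θ p.1.2.1 p.1.2.2 p.2 :=
        (M.continuous_step θ ε hdrift).measurable.comp ((measurable_fst.comp hfst).prodMk
          ((measurable_snd.comp hfst).prodMk measurable_snd))
      exact (measurable_fst.comp measurable_fst).mul
        (((hW.continuous.measurable.comp h1).sub
          (hW.continuous.measurable.comp (measurable_fst.comp hfst))).add
          ((hrew.measurable.comp hfst).const_mul ε))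
    have hY : Measurable[N.past n] fun ω => (N.arrived T n ω, X n ω, A n ω) := by
      have hg : Measurable fun t : ℝ≥0 => if t ≤ T then (1 : ℝ) else 0 :=
        Measurable.ite measurableSet_Iic measurable_const measurable_const
      exact (hg.comp (N.measurable_τ_past n n)).prodMk ((hXp n).prodMk (hAp n))
    have hFe : (fun ω => F ((N.arrived T n ω, X n ω, A n ω), N.ξ (n + 1) ω)) = fun ω =>
        N.arrived T n ω * (W (X (n + 1) ω) - W (X n ω) + ε * M.reward (X n ω) (A n ω)) := rfl
    have i1 := N.integrable_arrived_mul T n (hWX (n + 1))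
    have i2 := N.integrable_arrived_mul T n (hWX n)
    have i3 := N.integrable_arrived_mul T n (hRint n)
    have hint : Integrable
        (fun ω => F ((N.arrived T n ω, X n ω, A n ω), N.ξ (n + 1) ω)) P := by
      rw [hFe]
      exact N.integrable_arrived_mul T n (((hWX (n + 1)).sub (hWX n)).add (hRint n))
    obtain ⟨hi, he⟩ := N.integral_past n hY hF hint
    have hinner : ∀ ω, ∫ z, F ((N.arrived T n ω, X n ω, A n ω), z) ∂(stdGaussian (Vec d)) =
        N.arrived T n ω * M.hamiltonian ε θ W (X n ω) (A n ω) := by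
      intro ω
      have hz : Integrable (fun z => W (M.step ε θ (X n ω) (A n ω) z)) (stdGaussian (Vec d)) := by
        have hid : Integrable (fun z : Vec d => z) (stdGaussian (Vec d)) :=
          IsGaussian.integrable_fun_id
        have hs : Integrable (fun z => M.step ε θ (X n ω) (A n ω) z) (stdGaussian (Vec d)) :=
          (integrable_const _).add (((Matrix.toEuclideanCLM (n := Fin d) (𝕜 := ℝ)
            M.vol).integrable_comp hid).smul (Real.sqrt ε))
        refine ((integrable_const |W 0|).add (hs.norm.const_mul (C : ℝ))).mono'
          (hW.continuous.comp_aestronglyMeasurable hs.aestronglyMeasurable)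
          (Eventually.of_forall fun z => ?_)
        have h1 := hWle (M.step ε θ (X n ω) (A n ω) z) 0
        rw [sub_zero] at h1
        have h2 := abs_sub_abs_le_abs_sub (W (M.step ε θ (X n ω) (A n ω) z)) (W 0)
        simp only [Real.norm_eq_abs, Pi.add_apply]
        linarith
      have hz' : Integrable (fun z => W (M.step ε θ (X n ω) (A n ω) z) - W (X n ω))
          (stdGaussian (Vec d)) := hz.sub (integrable_const _)
      simp only [F]
      rw [integral_const_mul, integral_add hz' (integrable_const _),
        integral_sub hz (integrable_const _)]
      simp [hamiltonian]
    simp only [hinner] at hi he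
    refine ⟨hi, ?_⟩
    rw [← he, hFe]
    have e2 : (fun ω => N.arrived T n ω *
        (W (X (n + 1) ω) - W (X n ω) + ε * M.reward (X n ω) (A n ω))) = fun ω =>
        (N.arrived T n ω * W (X (n + 1) ω) - N.arrived T n ω * W (X n ω)) +
          N.arrived T n ω * (ε * M.reward (X n ω) (A n ω)) := by ext ω; ring
    have i12 : Integrable (fun ω => N.arrived T n ω * W (X (n + 1) ω) -
        N.arrived T n ω * W (X n ω)) P := i1.sub i2
    rw [e2, integral_add i12 i3, integral_sub i1 i2]
    ring
  -- The random number of rewards becomes a deterministic series with indicators; bounded rewards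
  -- and summable arrival probabilities allow the interchange with the expectation.
  have hsum : HasSum (fun n => ∫ ω, N.arrived T (n + 1) ω *
      (ε * M.reward (X (n + 1) ω) (A (n + 1) ω)) ∂P)
      (∫ ω, (∑ n ∈ Finset.Icc 1 (N.count T ω), ε * M.reward (X n ω) (A n ω)) ∂P) := by
    have h1 := hasSum_integral_of_summable_integral_norm
      (fun n => N.integrable_arrived_mul T (n + 1) (hRint (n + 1))) (by
        refine Summable.of_nonneg_of_le (fun n => integral_nonneg fun ω => norm_nonneg _)
          (fun n => ?_) (((summable_nat_add_iff 1).2 (N.summable_prob hε T)).mul_right (ε * R))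
        unfold MarkedPoisson.prob
        rw [← integral_mul_const]
        refine integral_mono (N.integrable_arrived_mul T (n + 1) (hRint (n + 1))).norm
          ((N.integrable_arrived T (n + 1)).mul_const _) fun ω => ?_
        simp only
        rw [Real.norm_eq_abs, abs_mul, abs_of_nonneg (N.arrived_nonneg _ _ _), abs_mul,
          abs_of_pos hε]
        exact mul_le_mul_of_nonneg_left (mul_le_mul_of_nonneg_left (hR _ _) hε.le)
          (N.arrived_nonneg _ _ _))
    convert! h1 using 1
    refine integral_congr_ae ?_
    filter_upwards [N.ae_regular hε] with ω hω
    have harr : ∀ n, N.arrived T n ω = if n ≤ N.count T ω then 1 else 0 := fun n => by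
      simp only [MarkedPoisson.arrived, N.le_count_iff hω]
    rw [tsum_eq_sum (s := Finset.range (N.count T ω)) fun n hn => by
      rw [harr, if_neg (by simpa using hn), zero_mul]]
    rw [← Finset.Ico_add_one_right_eq_Icc, Finset.sum_Ico_eq_sum_range]
    refine Finset.sum_congr (by simp) fun n hn => ?_
    rw [harr, if_pos (by simpa using hn), one_mul, add_comm 1 n]
  have hlim := hsum.tendsto_sum_nat
  have hprob := (((summable_nat_add_iff 1).2 (N.summable_prob hε T)).hasSum.tendsto_sum_nat).const_mul g
  constructor
  · intro hH
    refine le_of_tendsto_of_tendsto' hlim (hprob.add_const _) fun m => ?_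
    simp only [(hstep _).2]
    rw [Finset.sum_sub_distrib, Finset.mul_sum]
    have h1 : ∑ n ∈ Finset.range m, ∫ ω, N.arrived T (n + 1) ω *
        M.hamiltonian ε θ W (X (n + 1) ω) (A (n + 1) ω) ∂P ≤
        ∑ n ∈ Finset.range m, g * N.prob T (n + 1) := by
      refine Finset.sum_le_sum fun n _ => ?_
      unfold MarkedPoisson.prob
      rw [← integral_const_mul]
      refine integral_mono (hstep _).1 ((N.integrable_arrived T _).const_mul g) fun ω => ?_
      simp only
      rw [mul_comm g]
      exact mul_le_mul_of_nonneg_left (hH _ _) (N.arrived_nonneg _ _ _)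
    have h2 := (abs_le.1 (hincr m)).1
    linarith
  · intro hH
    refine le_of_tendsto_of_tendsto' (hprob.sub_const _) hlim fun m => ?_
    simp only [(hstep _).2]
    rw [Finset.sum_sub_distrib, Finset.mul_sum]
    have h1 : ∑ n ∈ Finset.range m, ∫ ω, N.arrived T (n + 1) ω *
        M.hamiltonian ε θ W (X (n + 1) ω) (A (n + 1) ω) ∂P =
        ∑ n ∈ Finset.range m, g * N.prob T (n + 1) := by
      refine Finset.sum_congr rfl fun n _ => ?_
      unfold MarkedPoisson.prob
      rw [← integral_const_mul]
      refine integral_congr_ae ?_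
      filter_upwards [hH] with ω hω
      rw [hω, mul_comm]
    have h2 := (abs_le.1 (hincr m)).2
    linarith

end JumpModel

/-! ### Uniform bounds from the assumptions on the model -/

lemma norm_le_of_enorm_le {F : Type*} [NormedAddCommGroup F] {x : F} {C : ℝ} (hC : 0 ≤ C)
    (h : ‖x‖ₑ ≤ ENNReal.ofReal C) : ‖x‖ ≤ C := by
  rwa [← ofReal_norm, ENNReal.ofReal_le_ofReal_iff hC] at h

lemma norm_le_of_enorm_div_le {E F : Type*} [NormedAddCommGroup E] [NormedAddCommGroup F] {x : F}
    {y : E} {C : ℝ} (hC : 0 ≤ C) (hy : y ≠ 0) (h : ‖x‖ₑ / ‖y‖ₑ ≤ ENNReal.ofReal C) :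
    ‖x‖ ≤ C * ‖y‖ := by
  rw [ENNReal.div_le_iff (enorm_ne_zero.2 hy) enorm_ne_top, ← ofReal_norm y,
    ← ENNReal.ofReal_mul hC] at h
  exact norm_le_of_enorm_le (mul_nonneg hC (norm_nonneg y)) h

/-- A nonnegative function which is dominated by the norm and has a bounded gradient off the origin
grows at most linearly. -/
lemma le_add_of_norm_gradient_le {E : Type*} [NormedAddCommGroup E] [InnerProductSpace ℝ E]
    [CompleteSpace E] {V : E → ℝ} {L B : ℝ} (hV0 : ∀ x, 0 ≤ V x) (hVL : ∀ x, V x ≤ L * ‖x‖)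
    (hd : ∀ x, x ≠ 0 → DifferentiableAt ℝ V x) (hB : ∀ x, x ≠ 0 → ‖gradient V x‖ ≤ B)
    (hL : 0 ≤ L) (x y : E) : V (x + y) ≤ V x + max B L * ‖y‖ := by
  -- The mean value inequality applies unless the segment meets the origin, where `V` need not be
  -- differentiable. In that case `x + y` is a fraction of `y`, and `V ≤ L * ‖·‖` suffices.
  by_cases h : (0 : E) ∈ segment ℝ x (x + y)
  · rw [segment_eq_image'] at h
    obtain ⟨t, ⟨ht0, ht1⟩, ht⟩ := h
    simp only [add_sub_cancel_left] at ht
    have e : x + y = (1 - t) • y := by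
      rw [sub_smul, one_smul, eq_neg_of_add_eq_zero_left ht]; abel
    have h1 : V (x + y) ≤ L * ‖y‖ := by
      refine (hVL _).trans (mul_le_mul_of_nonneg_left ?_ hL)
      rw [e, norm_smul, Real.norm_eq_abs, abs_of_nonneg (by linarith)]
      exact mul_le_of_le_one_left (norm_nonneg y) (by linarith)
    have h2 := mul_le_mul_of_nonneg_right (le_max_right B L) (norm_nonneg y)
    linarith [hV0 x]
  · have hne : ∀ z ∈ segment ℝ x (x + y), z ≠ 0 := fun z hz hz0 => h (hz0 ▸ hz)
    have h1 := (convex_segment x (x + y)).norm_image_sub_le_of_norm_fderiv_le (𝕜 := ℝ) (f := V)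
      (fun z hz => hd z (hne z hz)) (C := B) (fun z hz => by
        have := hB z (hne z hz)
        rwa [gradient, LinearIsometryEquiv.norm_map] at this)
      (left_mem_segment ℝ x (x + y)) (right_mem_segment ℝ x (x + y))
    rw [add_sub_cancel_left] at h1
    have h2 := mul_le_mul_of_nonneg_right (le_max_left B L) (norm_nonneg y)
    have h3 := (le_abs_self _).trans h1
    linarith

namespace MarkedPoisson

variable {d : ℕ} {ε : ℝ} {Ω : Type*} [MeasurableSpace Ω] {P : Measure Ω} [IsProbabilityMeasure P]
  (N : MarkedPoisson d ε P)

lemma tendsto_bound (hε : 0 < ε) (g c : ℝ) :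
    Tendsto (fun T : ℝ≥0 => (((1 / (T : ℝ)) * (g * ∑' n, N.prob T (n + 1) + c) : ℝ) : EReal)) atTop
      (𝓝 ((g * ε⁻¹ : ℝ) : EReal)) := by
  refine (continuous_coe_real_ereal.tendsto _).comp ?_
  have hinv : Tendsto (fun T : ℝ≥0 => (T : ℝ)⁻¹) atTop (𝓝 0) :=
    tendsto_inv_atTop_zero.comp (NNReal.tendsto_coe_atTop.2 tendsto_id)
  have h := ((N.tendsto_mean_count hε).const_mul g).add (hinv.mul_const c)
  rw [zero_mul, add_zero] at h
  refine h.congr fun T => ?_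
  rw [one_div]; ring

end MarkedPoisson

namespace JumpModel

variable {d k q : ℕ} (M : JumpModel d k q)

lemma Regular.bounds {M : JumpModel d k q} (h : M.Regular) :
    ∃ L₀ : ℝ, 0 < L₀ ∧ ∀ (θ : M.Theta) (a : M.Act), ‖M.drift θ 0 a‖ ≤ L₀ ∧
      (∀ x, |M.reward x a| ≤ L₀) ∧ ∀ x x', |M.reward x a - M.reward x' a| ≤ L₀ * ‖x - x'‖ := by
  obtain ⟨-, -, ⟨L₀, hL₀, hsup, -⟩, -⟩ := h
  refine ⟨L₀, hL₀, fun θ a => ?_⟩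
  have hs := (hsup θ a).le
  refine ⟨?_, fun x => ?_, fun x x' => ?_⟩
  · refine norm_le_of_enorm_le hL₀.le (le_trans ?_ hs)
    refine le_trans ?_ (le_self_add.trans (le_self_add.trans le_self_add))
    refine le_trans ?_ (le_iSup (fun x : Vec d => ‖M.drift θ x a‖ₑ / (1 + ‖x‖ₑ)) 0)
    simp
  · refine norm_le_of_enorm_le (x := M.reward x a) hL₀.le (le_trans ?_ hs)
    refine le_trans ?_ (le_add_self.trans le_self_add)
    exact le_iSup (fun x : Vec d => ‖M.reward x a‖ₑ) x
  · by_cases hx : x = x'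
    · simp [hx]
    refine norm_le_of_enorm_div_le (x := M.reward x a - M.reward x' a) hL₀.le (sub_ne_zero.2 hx) (le_trans ?_ hs)
    refine le_trans ?_ le_add_self
    exact le_iSup_of_le x (le_iSup_of_le x' (le_iSup_of_le hx le_rfl))

/-- The constants and the properties of the Lyapunov function, uniformly over time scales up to
and including `1`. -/
lemma Stable.bounds {M : JumpModel d k q} (hd : 0 < d) (h : M.Stable) :
    ∃ (l L c C : ℝ) (V : Vec d → ℝ), 0 < l ∧ 0 < L ∧ 0 < c ∧ 0 ≤ C ∧ (∀ x, 0 ≤ V x) ∧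
      (∀ x, l * ‖x‖ ≤ V x) ∧ (∀ x, V x ≤ L * ‖x‖) ∧ (∀ x y, V (x + y) ≤ V x + C * ‖y‖) ∧
      ∀ (θ : M.Theta) (a : M.Act) (ε : ℝ), ε ∈ Ioc (0 : ℝ) 1 → 0 ≤ 1 - ε * c ∧
        ∀ x x', V ((x + ε • M.drift θ x a) - (x' + ε • M.drift θ x' a)) ≤
          (1 - ε * c) * V (x - x') := by
  obtain ⟨l, L, c, B, V, hl, hL, hc, hB, hV0, hVpos, hVd, hVl, hVB, hVc⟩ := h
  have hVnn : ∀ x, 0 ≤ V x := fun x => by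
    by_cases hx : x = 0
    · rw [hx, hV0]
    · exact (hVpos x hx).le
  have hlow : ∀ x, l * ‖x‖ ≤ V x := fun x => by
    by_cases hx : x = 0
    · simp [hx, hV0]
    · simpa using (hVl x 0 hx).1
  have hup : ∀ x, V x ≤ L * ‖x‖ := fun x => by
    by_cases hx : x = 0
    · simp [hx, hV0]
    · simpa using (hVl x 0 hx).2
  have hgrow := le_add_of_norm_gradient_le hVnn hup (fun x hx =>
    (hVd.contDiffAt (isOpen_compl_singleton.mem_nhds hx)).differentiableAt (by norm_num)) hVB hL.le
  have hC : 0 ≤ max B L := hL.le.trans (le_max_right _ _)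
  have hVcont : Continuous V := by
    refine (LipschitzWith.of_dist_le_mul (K := (max B L).toNNReal) fun x y => ?_).continuous
    rw [Real.coe_toNNReal _ hC, Real.dist_eq, dist_eq_norm, abs_sub_le_iff]
    have h1 := hgrow y (x - y)
    have h2 := hgrow x (y - x)
    rw [add_sub_cancel] at h1 h2
    rw [norm_sub_rev] at h2
    constructor <;> linarith
  refine ⟨l, L, c, max B L, V, hl, hL, hc, hC, hVnn, hlow, hup, hgrow, fun θ a ε hε => ?_⟩
  have hcontr : ∀ x x', V ((x + ε • M.drift θ x a) - (x' + ε • M.drift θ x' a)) ≤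
      (1 - ε * c) * V (x - x') := by
    intro x x'
    by_cases hx : x = x'
    · simp [hx, hV0]
    let f : ℝ → ℝ := fun δ => V ((x + δ • M.drift θ x a) - (x' + δ • M.drift θ x' a))
    have hf : Continuous f := hVcont.comp (by fun_prop)
    -- Contraction is assumed for step sizes below `1`; continuity of `V` extends it to the closed
    -- interval.
    have hcl : IsClosed {δ : ℝ | f δ ≤ (1 - δ * c) * V (x - x')} :=
      isClosed_le hf (by fun_prop)
    have hsub : Ioo (0 : ℝ) 1 ⊆ {δ : ℝ | f δ ≤ (1 - δ * c) * V (x - x')} := fun δ hδ => by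
      have := hVc θ a x x' δ hx hδ
      rwa [sub_sub] at this
    have hcl2 := closure_minimal hsub hcl
    rw [closure_Ioo zero_ne_one] at hcl2
    exact hcl2 ⟨hε.1.le, hε.2⟩
  refine ⟨?_, hcontr⟩
  -- Applying the contraction to a nonzero vector, which exists as `0 < d`, forces `1 - ε * c ≥ 0`
  -- because `V` is nonnegative.
  have hx : (EuclideanSpace.single (⟨0, hd⟩ : Fin d) (1 : ℝ)) ≠ 0 := by simp
  have h1 := (hVnn _).trans (hcontr (EuclideanSpace.single (⟨0, hd⟩ : Fin d) (1 : ℝ)) 0)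
  rw [sub_zero] at h1
  exact nonneg_of_mul_nonneg_left h1 (hVpos _ hx)

variable {ε : ℝ} {Ω : Type*} [mΩ : MeasurableSpace Ω] {P : Measure Ω} [IsProbabilityMeasure P]
  (N : MarkedPoisson d ε P) (θ : M.Theta)

/-- The noise `√ε Σ̄ z` of a transition. -/
def noise (ε : ℝ) (z : Vec d) : Vec d :=
  Real.sqrt ε • Matrix.toEuclideanCLM (n := Fin d) (𝕜 := ℝ) M.vol z

lemma integrable_noise (ε : ℝ) : Integrable (M.noise ε) (stdGaussian (Vec d)) := by
  have hid : Integrable (fun z : Vec d => z) (stdGaussian (Vec d)) := IsGaussian.integrable_fun_id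
  exact ((Matrix.toEuclideanCLM (n := Fin d) (𝕜 := ℝ) M.vol).integrable_comp hid).smul (Real.sqrt ε)

lemma measurable_noise (ε : ℝ) : Measurable (M.noise ε) :=
  ((Matrix.toEuclideanCLM (n := Fin d) (𝕜 := ℝ) M.vol).continuous.const_smul (Real.sqrt ε)).measurable

/-- The controlled states are dominated, uniformly over controls, by variables which are bounded in
mean and independent of the arrival times. -/
theorem exists_dominating {l C r L₀ : ℝ} {V : Vec d → ℝ} (hl : 0 < l) (hC : 0 ≤ C) (hε : 0 < ε)
    (hr0 : 0 ≤ r) (hr1 : r < 1) (hlow : ∀ x, l * ‖x‖ ≤ V x)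
    (hgrow : ∀ x y, V (x + y) ≤ V x + C * ‖y‖) (hdrift : ∀ a, ‖M.drift θ 0 a‖ ≤ L₀)
    (hcontr : ∀ x a, V ((x + ε • M.drift θ x a) - ε • M.drift θ 0 a) ≤ r * V x) (x₀ : Vec d) :
    ∃ (B : ℕ → Ω → ℝ) (b : ℝ), (∀ n, Integrable (B n) P) ∧
      (∀ i n, IndepFun (N.τ i) (B n) P) ∧ (∀ n, ∫ ω, B n ω ∂P ≤ b) ∧
      ∀ α n ω, ‖M.stateAt N θ x₀ α n ω‖ ≤ B n ω := by
  let f : Vec d → ℝ := fun z => C * (ε * L₀ + ‖M.noise ε z‖)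
  have hf : Measurable f := ((M.measurable_noise ε).norm.const_add _).const_mul C
  have hfi : Integrable f (stdGaussian (Vec d)) :=
    ((integrable_const _).add (M.integrable_noise ε).norm).const_mul C
  -- Any `b` above `∫ f / (1 - r)` satisfies `r * b + ∫ f ≤ b`; the maximum with `V x₀` covers the
  -- start of the recursion.
  let b := max (V x₀) ((∫ z, f z ∂(stdGaussian (Vec d))) / (1 - r))
  have hb : r * b + ∫ z, f z ∂(stdGaussian (Vec d)) ≤ b := by
    have h1 : (∫ z, f z ∂(stdGaussian (Vec d))) / (1 - r) ≤ b := le_max_right _ _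
    have h := (div_le_iff₀ (by linarith : 0 < 1 - r)).1 h1
    linarith
  let Z : ℕ → Ω → ℝ := fun n ω => MarkedPoisson.linRec r (V x₀) (fun i => f (N.ξ i ω)) n
  have hZ := N.linRec_marks hf hfi hr0 (le_max_left (V x₀) _) hb
  refine ⟨fun n ω => l⁻¹ * Z n ω, l⁻¹ * b, fun n => (hZ n).1.const_mul _,
    fun i n => ((hZ n).2.2 i).comp measurable_id (measurable_id.const_mul l⁻¹), fun n => ?_,
    fun α n ω => ?_⟩
  · rw [integral_const_mul]
    exact mul_le_mul_of_nonneg_left (hZ n).2.1 (inv_nonneg.2 hl.le)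
  · have hV : ∀ n, V (M.stateAt N θ x₀ α n ω) ≤ Z n ω := by
      intro n
      induction n with
      | zero => exact le_rfl
      | succ n ih =>
        set x := M.stateAt N θ x₀ α n ω
        set a := α (N.τ n ω) ω
        -- Comparison with the drift at `0` under the same action: the first bracket is contracted,
        -- and the rest is bounded by a quantity depending on the mark alone.
        have e : M.stateAt N θ x₀ α (n + 1) ω = ((x + ε • M.drift θ x a) - ε • M.drift θ 0 a) +
            (ε • M.drift θ 0 a + M.noise ε (N.ξ (n + 1) ω)) := by
          rw [← add_assoc, sub_add_cancel]; rfl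
        rw [e]
        refine (hgrow _ _).trans (add_le_add ((hcontr x a).trans
          (mul_le_mul_of_nonneg_left ih hr0)) (mul_le_mul_of_nonneg_left ?_ hC))
        refine (norm_add_le _ _).trans (add_le_add ?_ le_rfl)
        rw [norm_smul, Real.norm_eq_abs, abs_of_pos hε]
        exact mul_le_mul_of_nonneg_left (hdrift a) hε.le
    simp only
    rw [inv_mul_eq_div, le_div_iff₀ hl, mul_comm]
    exact (hlow _).trans (hV n)

-- The pathwise identity is read at time `τ n`, where the count equals `n` on regular paths.
omit [IsProbabilityMeasure P] in
lemma IsMarkovControl.ae_eq {M : JumpModel d k q} {N : MarkedPoisson d ε P} {θ : M.Theta}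
    [IsProbabilityMeasure P] {x₀ : Vec d} {π : Vec d → M.Act} {α : ℝ≥0 → Ω → M.Act} (hε : 0 < ε)
    (h : M.IsMarkovControl N θ x₀ π α) :
    ∀ᵐ ω ∂P, ∀ n, α (N.τ n ω) ω = π (M.stateAt N θ x₀ α n ω) := by
  filter_upwards [h.2, N.ae_regular hε] with ω h1 h2 n
  rw [h1, state, N.count_τ h2]

end JumpModel

/-! ### Proof of the proposition -/

theorem mainTheorem9 {d k q : ℕ} (hd : 0 < d) (M : JumpModel d k q)
    (hne : M.Act.Nonempty) (hcomp : IsCompact M.Act) (hreg : M.Regular) (hstab : M.Stable) :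
    ∃ LW : ℝ≥0, 0 < LW ∧
      ∀ (ε : ℝ), ε ∈ Ioc (0 : ℝ) 1 →
      ∀ (Ω : Type*) [MeasurableSpace Ω] (P : Measure Ω) [IsProbabilityMeasure P]
        (N : MarkedPoisson d ε P) (θ : M.Theta),
        ∃ ρ : ℝ, (∀ x₀, M.optReward N θ x₀ = (ρ : EReal)) ∧
          ∃ W : Vec d → ℝ, LipschitzWith LW W ∧
            (∀ x, IsGreatest (Set.range (M.hamiltonian ε θ W x)) (ε * ρ)) ∧
            (∃ π : Vec d → M.Act, Measurable π ∧
              ∀ x a, M.hamiltonian ε θ W x a ≤ M.hamiltonian ε θ W x (π x)) ∧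
            (∀ π : Vec d → M.Act, Measurable π →
              (∀ x a, M.hamiltonian ε θ W x a ≤ M.hamiltonian ε θ W x (π x)) →
              ∀ x₀, (∃ α, M.IsMarkovControl N θ x₀ π α) ∧
                ∀ α, M.IsMarkovControl N θ x₀ π α → M.avgReward N θ α x₀ = (ρ : EReal)) := by
  obtain ⟨L₀, hL₀, hbd⟩ := hreg.bounds
  obtain ⟨l, L, c, C, V, hl, hL, hc, hC, hVnn, hlow, hup, hgrow, hcontr⟩ := hstab.bounds hd
  have hK : 0 < L₀ / (l * c) := by positivity
  refine ⟨(L₀ / (l * c) * L).toNNReal, Real.toNNReal_pos.2 (by positivity), ?_⟩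
  intro ε hε Ω _ P _ N θ
  have : CompactSpace M.Act := isCompact_iff_compactSpace.1 hcomp
  have : Nonempty M.Act := hne.to_subtype
  have a₀ : M.Act := Classical.arbitrary _
  have hε0 := hε.1
  have hdrift : Continuous fun p : Vec d × M.Act => M.drift θ p.1 p.2 :=
    hreg.1.comp (continuous_const.prodMk continuous_id)
  have hrew : Continuous fun p : Vec d × M.Act => M.reward p.1 p.2 := hreg.2.1
  have hm : Continuous fun p : Vec d × M.Act => p.1 + ε • M.drift θ p.1 p.2 :=
    continuous_fst.add (hdrift.const_smul ε)
  let D : ContractiveDecision (Vec d) M.Act (Vec d) (stdGaussian (Vec d)) :=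
    { m := fun x a => x + ε • M.drift θ x a
      r := fun x a => ε * M.reward x a
      s := M.noise ε
      V := V
      -- The solution of `K * (1 - ε * c) + ε * L₀ / l = K`, in which `ε` cancels.
      K := L₀ / (l * c)
      L := L
      R := ε * L₀
      q := 1 - ε * c
      κ := ε * L₀ / l
      continuous_m := fun x => hm.comp (Continuous.prodMk_right x)
      continuous_r := fun x => (hrew.comp (Continuous.prodMk_right x)).const_mul ε
      integrable_s := M.integrable_noise ε
      abs_r_le := fun x a => by
        rw [abs_mul, abs_of_pos hε0]
        exact mul_le_mul_of_nonneg_left ((hbd θ a).2.1 x) hε0.le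
      V_nonneg := hVnn
      V_le := hup
      L_nonneg := hL.le
      K_nonneg := hK.le
      q_nonneg := (hcontr θ a₀ ε hε).1
      contract := fun x y a => (hcontr θ a ε hε).2 x y
      r_sub_le := fun x y a => by
        have h1 := (le_abs_self _).trans ((hbd θ a).2.2 x y)
        have h2 : ‖x - y‖ ≤ V (x - y) / l := by
          rw [le_div_iff₀ hl, mul_comm]; exact hlow _
        calc ε * M.reward x a - ε * M.reward y a = ε * (M.reward x a - M.reward y a) := by ring
          _ ≤ ε * (L₀ * (V (x - y) / l)) := mul_le_mul_of_nonneg_left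
              (h1.trans (mul_le_mul_of_nonneg_left h2 hL₀.le)) hε0.le
          _ = _ := by ring
      modulus := le_of_eq (by field_simp; ring) }
  obtain ⟨g, W, hWmod, hW⟩ := D.exists_average
  have hHD : ∀ x, M.hamiltonian ε θ W x = fun a => D.expect W x a - W x + D.r x a := fun x => rfl
  have hLip : LipschitzWith (L₀ / (l * c) * L).toNNReal W := hWmod.lipschitzWith
  have hmax : ∀ x, IsGreatest (Set.range (M.hamiltonian ε θ W x)) g := fun x => by
    rw [hHD]; exact hW x
  have hHle : ∀ x a, M.hamiltonian ε θ W x a ≤ g := fun x a => (hmax x).2 ⟨a, rfl⟩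
  have hHcont : Continuous (Function.uncurry (M.hamiltonian ε θ W)) :=
    ((hWmod.continuous_integral.comp hm).sub (hLip.continuous.comp continuous_fst)).add
      (hrew.const_mul ε)
  have hargmax := exists_measurable_argmax hHcont
  have hq1 : 1 - ε * c < 1 := by linarith [mul_pos hε0 hc]
  have hdom := fun x₀ => M.exists_dominating N θ hl hC hε0 (hcontr θ a₀ ε hε).1 hq1 hlow hgrow
    (fun a => (hbd θ a).1) (fun x a => by simpa using (hcontr θ a ε hε).2 x 0) x₀
  have hupper : ∀ x₀, ∀ α ∈ M.controls N, M.avgReward N θ α x₀ ≤ ((g * ε⁻¹ : ℝ) : EReal) := by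
    intro x₀ α hα
    obtain ⟨B, b, hB, hind, hb, hle⟩ := hdom x₀
    -- The limit is rewritten as the liminf of the explicit bounds, so that the two can be compared
    -- for each `T`.
    rw [← (N.tendsto_bound hε0 g (2 * (|W 0| +
      (L₀ / (l * c) * L).toNNReal * b))).liminf_eq]
    refine liminf_le_liminf (Eventually.of_forall fun T => EReal.coe_le_coe_iff.2
      (mul_le_mul_of_nonneg_left ?_ (by positivity)))
    exact (M.abs_reward_sub_le N θ hε0 hdrift hrew (fun x a => (hbd θ a).2.1 x) hLip x₀ hα hB
      (hle α) hind hb T g).1 hHle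
  have hMarkov : ∀ π : Vec d → M.Act,
      (∀ x a, M.hamiltonian ε θ W x a ≤ M.hamiltonian ε θ W x (π x)) → ∀ x₀ α,
      M.IsMarkovControl N θ x₀ π α → M.avgReward N θ α x₀ = ((g * ε⁻¹ : ℝ) : EReal) := by
    intro π hπ x₀ α hα
    refine le_antisymm (hupper x₀ α hα.1) ?_
    obtain ⟨B, b, hB, hind, hb, hle⟩ := hdom x₀
    rw [← (N.tendsto_bound hε0 g (-(2 * (|W 0| +
      (L₀ / (l * c) * L).toNNReal * b)))).liminf_eq]
    refine liminf_le_liminf (Eventually.of_forall fun T => EReal.coe_le_coe_iff.2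
      (mul_le_mul_of_nonneg_left ?_ (by positivity)))
    rw [← sub_eq_add_neg]
    refine (M.abs_reward_sub_le N θ hε0 hdrift hrew (fun x a => (hbd θ a).2.1 x) hLip x₀ hα.1 hB
      (hle α) hind hb T g).2 ?_
    filter_upwards [hα.ae_eq hε0] with ω hω n
    rw [hω n]
    -- Since `g` is attained by some action, a pointwise maximiser has Hamiltonian exactly `g` along
    -- the path.
    obtain ⟨a, ha⟩ := (hmax (M.stateAt N θ x₀ α n ω)).1
    exact le_antisymm (hHle _ _) (ha ▸ hπ _ a)
  have hexists := fun π (hπ : Measurable π) => M.exists_isMarkovControl N θ hε0 hne hdrift hπ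
  refine ⟨g * ε⁻¹, fun x₀ => ?_, W, hLip, fun x => ?_, hargmax, fun π hπm hπ x₀ =>
    ⟨hexists π hπm x₀, hMarkov π hπ x₀⟩⟩
  · refine le_antisymm (iSup₂_le (hupper x₀)) ?_
    obtain ⟨π, hπm, hπ⟩ := hargmax
    obtain ⟨α, hα⟩ := hexists π hπm x₀
    rw [← hMarkov π hπ x₀ α hα]
    exact le_iSup₂ (f := fun α (_ : α ∈ M.controls N) => M.avgReward N θ α x₀) α hα.1
  · rw [mul_comm g, mul_inv_cancel_left₀ hε0.ne']
    exact hmax x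

end
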